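/- Let $d,m,S\ge 1$ be integers and let $\|\cdot\|$ denote arbitrary fixed norms on $\mathbb R^d$, $\mathbb R^m$, $\mathbb R^{d\times d}$ and $\mathbb R^{m\times d}$. Let $\sigma:\mathbb R^d\to\mathbb R^d$ be Lipschitz continuous with $\sigma(0)=0$, let $h:\mathbb R^m\to\mathbb R^m$ be continuous, let $\alpha_1,\alpha_2,\alpha_3,\alpha_4,\tau_1,\tau_2>0$, and let $(x_s,y_s)_{s=1}^S\subset\mathbb R^d\times\mathbb R^m$ be training data. For $n\ge1$ let $\Theta^{(n)}$ be the set of all $\theta=(K,b,W,c)$ with $K=(K_i)_{i=0}^{n-1}\subset\mathbb R^{d\times d}$, $b=(b_i)_{i=0}^{n-1}\subset\mathbb R^d$, $W\in\mathbb R^{m\times d}$, $c\in\mathbb R^m$. For $x\in\mathbb R^d$ put $X_0^{(n)}=x$ and $X^{(n)}_{i+1}=X^{(n)}_i+\frac1n\sigma(K_iX^{(n)}_i+b_i)$ for $0\le i\le n-1$, and write $X_n^{(n)}[x;K,b]$ for the last state. Let $$\mathcal E_n(\theta)=\sum_{s=1}^S\big\|h(WX^{(n)}_n[x_s;K,b]+c)-y_s\big\|^2+\alpha_1\Big(n\sum_{i=1}^{n-1}\|K_i-K_{i-1}\|^2+\tau_1\|K_0\|^2\Big)+\alpha_2\Big(n\sum_{i=1}^{n-1}\|b_i-b_{i-1}\|^2+\tau_2\|b_0\|^2\Big)+\alpha_3\|W\|^2+\alpha_4\|c\|^2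 .$$ Let $\Theta=H^1([0,1];\mathbb R^{d\times d})\times H^1([0,1];\mathbb R^d)\times\mathbb R^{m\times d}\times\mathbb R^m$, where elements of $H^1$ are identified with their continuous representatives. For $(K,b,W,c)\in\Theta$ and $x\in\mathbb R^d$ the problem $\dot X(t)=\sigma(K(t)X(t)+b(t))$, $t\in[0,1]$, $X(0)=x$, has exactly one solution, denoted $X(\cdot\,;x,K,b)$. Let $$\mathcal E_\infty(K,b,W,c)=\sum_{s=1}^S\big\|h(WX(1;x_s,K,b)+c)-y_s\big\|^2+\alpha_1\big(\|\dot K\|_{L^2}^2+\tau_1\|K(0)\|^2\big)+\alpha_2\big(\|\dot b\|_{L^2}^2+\tau_2\|b(0)\|^2\big)+\alpha_3\|W\|^2+\alpha_4\|c\|^2 .$$ For $\theta^{(n)}=(K^{(n)},b^{(n)},W^{(n)},c^{(n)})\in\Theta^{(n)}$ and $\theta=(K,b,W,c)\in\Theta$ let $$d(\theta^{(n)},\theta)=\|\tilde K^{(n)}-K\|_{L^2([0,1])}+\|\tilde b^{(n)}-b\|_{L^2([0,1])}+\|W^{(n)}-W\|+\|c^{(n)}-c\|,$$ where $\tilde K^{(n)}(t)=K^{(n)}_i$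 and $\tilde b^{(n)}(t)=b^{(n)}_i$ for $t\in[\frac in,\frac{i+1}n)$, $i=0,\dots,n-1$. Then $\mathcal E_n$ has a minimiser in $\Theta^{(n)}$ for every $n\ge1$, and $\mathcal E_\infty$ has a minimiser in $\Theta$. Moreover, let $(\theta^{(n)})_{n\ge1}$ be any sequence such that $\theta^{(n)}$ is a minimiser of $\mathcal E_n$ in $\Theta^{(n)}$ for every $n$. Then 1. $\min_{\Theta^{(n)}}\mathcal E_n=\mathcal E_n(\theta^{(n)})\to\min_\Theta\mathcal E_\infty$ as $n\to\infty$; 2. $(\theta^{(n)})$ is relatively compact: every subsequence has a further subsequence $(\theta^{(n_k)})$ such that $d(\theta^{(n_k)},\theta)\to0$ for some $\theta\in\Theta$; 3. every limit point is a minimiser of $\mathcal E_\infty$: if $\theta\in\Theta$ and $d(\theta^{(n_k)},\theta)\to0$ along a subsequence, then $\mathcal E_\infty(\theta)\le\mathcal E_\infty(\theta')$ for all $\theta'\in\Theta$. -/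

import Mathlib

open MeasureTheory Filter Topology Set
open scoped ContDiff

noncomputable section

namespace DeepResNet

/-- `g` is a weak derivative of `f` on the interval `(0,1)`: integration by parts holds against
every smooth test function with compact support in `(0,1)`. -/
def IsWeakDeriv {V : Type*} [NormedAddCommGroup V] [NormedSpace ℝ V] (f g : ℝ → V) : Prop :=
  ∀ φ : ℝ → ℝ, ContDiff ℝ ∞ φ → HasCompactSupport φ → tsupport φ ⊆ Ioo (0 : ℝ) 1 →
    ∫ t in (0 : ℝ)..1, deriv φ t • f t = -∫ t in (0 : ℝ)..1, φ t • g t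

/-- `f` has a weak derivative in `L²([0,1]; V)`. -/
def HasL2WeakDeriv {V : Type*} [NormedAddCommGroup V] [NormedSpace ℝ V] (f : ℝ → V) : Prop :=
  ∃ g : ℝ → V, MemLp g 2 (volume.restrict (Icc (0 : ℝ) 1)) ∧ IsWeakDeriv f g

/-- Membership in `H¹([0,1]; V)`. An element of `H¹` is represented by its continuous
representative on `[0,1]` (so that its value at `0` makes sense); values of `f` outside `[0,1]`
play no role. -/
structure MemH1 {V : Type*} [NormedAddCommGroup V] [NormedSpace ℝ V] (f : ℝ → V) : Prop where
  continuousOn : ContinuousOn f (Icc (0 : ℝ) 1)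
  hasL2WeakDeriv : HasL2WeakDeriv f

open Classical in
/-- The weak derivative in `L²([0,1]; V)` (unique up to null sets), and `0` if there is none. -/
def weakDeriv {V : Type*} [NormedAddCommGroup V] [NormedSpace ℝ V] (f : ℝ → V) : ℝ → V :=
  if h : HasL2WeakDeriv f then h.choose else 0

section Params

-- Any norm on matrices gives the same `L²` functions, integrals and continuity; the entrywise
-- supremum norm is used for these. The norms in the functionals below are arbitrary.
attribute [local instance] Matrix.normedAddCommGroup Matrix.normedSpace

/-- The parameter space `Θ⁽ⁿ⁾` of the network with `n` layers. A function on the `n` points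
`0, 1/n, …, (n-1)/n` is given by the family of its `n` values. -/
structure DiscreteParam (d m n : ℕ) where
  K : Fin n → Matrix (Fin d) (Fin d) ℝ
  b : Fin n → Fin d → ℝ
  W : Matrix (Fin m) (Fin d) ℝ
  c : Fin m → ℝ

/-- The limiting parameter space `Θ = H¹([0,1]; ℝ^{d×d}) × H¹([0,1]; ℝ^d) × ℝ^{m×d} × ℝ^m`. -/
structure ContParam (d m : ℕ) where
  K : ℝ → Matrix (Fin d) (Fin d) ℝ
  b : ℝ → Fin d → ℝ
  W : Matrix (Fin m) (Fin d) ℝ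
  c : Fin m → ℝ
  memH1_K : MemH1 K
  memH1_b : MemH1 b

/-- The `i`-th entry of a family indexed by `0, …, n-1` (only used for `i < n`). -/
def layer {V : Type*} [Zero V] {n : ℕ} (u : Fin n → V) (i : ℕ) : V :=
  if hi : i < n then u ⟨i, hi⟩ else 0

/-- The piecewise constant extension: value `u i` for `t ∈ [i/n, (i+1)/n)`. -/
def extend {V : Type*} [Zero V] {n : ℕ} (u : Fin n → V) (t : ℝ) : V :=
  layer u ⌊(n : ℝ) * t⌋₊

/-- The data of the learning problem: activation function, classification function, the norms on
`ℝ^d`, `ℝ^m`, `ℝ^{d×d}`, `ℝ^{m×d}` (assumed definite in the theorem), the weights of the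
regularisation, and the training set. -/
structure Problem (d m S : ℕ) where
  σ : (Fin d → ℝ) → Fin d → ℝ
  h : (Fin m → ℝ) → Fin m → ℝ
  normd : Seminorm ℝ (Fin d → ℝ)
  normm : Seminorm ℝ (Fin m → ℝ)
  normdd : Seminorm ℝ (Matrix (Fin d) (Fin d) ℝ)
  normmd : Seminorm ℝ (Matrix (Fin m) (Fin d) ℝ)
  α₁ : ℝ
  α₂ : ℝ
  α₃ : ℝ
  α₄ : ℝ
  τ₁ : ℝ
  τ₂ : ℝ
  x : Fin S → Fin d → ℝ
  y : Fin S → Fin m → ℝ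

namespace Problem

variable {d m S : ℕ}

/-- The state `X_i` of the network with `n` layers started at `x₀`:
`X_{i+1} = X_i + (1/n) σ(K_i X_i + b_i)`. -/
def state (P : Problem d m S) {n : ℕ} (K : Fin n → Matrix (Fin d) (Fin d) ℝ)
    (b : Fin n → Fin d → ℝ) (x₀ : Fin d → ℝ) : ℕ → Fin d → ℝ
  | 0 => x₀
  | i + 1 => P.state K b x₀ i +
      (1 / (n : ℝ)) • P.σ ((layer K i).mulVec (P.state K b x₀ i) + layer b i)

/-- `n ∑_{i=1}^{n-1} ‖u_i - u_{i-1}‖² + τ ‖u_0‖²`. -/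
def discreteReg {V : Type*} [AddCommGroup V] [Module ℝ V] (N : Seminorm ℝ V) (τ : ℝ) {n : ℕ}
    (u : Fin n → V) : ℝ :=
  (n : ℝ) * ∑ i ∈ Finset.Ico 1 n, N (layer u i - layer u (i - 1)) ^ 2 + τ * N (layer u 0) ^ 2

/-- `‖u'‖²_{L²} + τ ‖u(0)‖²`, with the weak derivative `u'`. -/
def contReg {V : Type*} [NormedAddCommGroup V] [NormedSpace ℝ V] (N : Seminorm ℝ V) (τ : ℝ)
    (u : ℝ → V) : ℝ :=
  (∫ t in (0 : ℝ)..1, N (weakDeriv u t) ^ 2) + τ * N (u 0) ^ 2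

/-- The squared error `‖h(W X + c) - y‖²`, where `X` is the output of the hidden layers. -/
def error (P : Problem d m S) (W : Matrix (Fin m) (Fin d) ℝ) (c : Fin m → ℝ)
    (X : Fin d → ℝ) (y : Fin m → ℝ) : ℝ :=
  P.normm (P.h (W.mulVec X + c) - y) ^ 2

/-- The objective functional of the network with `n` layers. -/
def energy (P : Problem d m S) (n : ℕ) (θ : DiscreteParam d m n) : ℝ :=
  (∑ s : Fin S, P.error θ.W θ.c (P.state θ.K θ.b (P.x s) n) (P.y s))
    + P.α₁ * discreteReg P.normdd P.τ₁ θ.K + P.α₂ * discreteReg P.normd P.τ₂ θ.b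
    + P.α₃ * P.normmd θ.W ^ 2 + P.α₄ * P.normm θ.c ^ 2

/-- `X` solves `X'(t) = σ(K(t) X(t) + b(t))` on `[0,1]` with `X(0) = x₀` (one-sided derivatives
at the end points). -/
def IsSolution (P : Problem d m S) (K : ℝ → Matrix (Fin d) (Fin d) ℝ) (b : ℝ → Fin d → ℝ)
    (x₀ : Fin d → ℝ) (X : ℝ → Fin d → ℝ) : Prop :=
  X 0 = x₀ ∧ ∀ t ∈ Icc (0 : ℝ) 1,
    HasDerivWithinAt X (P.σ ((K t).mulVec (X t) + b t)) (Icc (0 : ℝ) 1) t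

open Classical in
/-- The solution `X(·; x₀, K, b)` of the differential equation, and `0` if there is none. -/
def solution (P : Problem d m S) (K : ℝ → Matrix (Fin d) (Fin d) ℝ) (b : ℝ → Fin d → ℝ)
    (x₀ : Fin d → ℝ) : ℝ → Fin d → ℝ :=
  if h : ∃ X, P.IsSolution K b x₀ X then h.choose else 0

/-- The limiting objective functional. -/
def limitEnergy (P : Problem d m S) (θ : ContParam d m) : ℝ :=
  (∑ s : Fin S, P.error θ.W θ.c (P.solution θ.K θ.b (P.x s) 1) (P.y s))
    + P.α₁ * contReg P.normdd P.τ₁ θ.K + P.α₂ * contReg P.normd P.τ₂ θ.b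
    + P.α₃ * P.normmd θ.W ^ 2 + P.α₄ * P.normm θ.c ^ 2

/-- The `L²([0,1])` distance between two functions, with respect to the norm `N`. -/
def distL2 {V : Type*} [AddCommGroup V] [Module ℝ V] (N : Seminorm ℝ V) (u v : ℝ → V) : ℝ :=
  Real.sqrt (∫ t in (0 : ℝ)..1, N (u t - v t) ^ 2)

/-- The discrete-to-continuum distance `d(θ⁽ⁿ⁾, θ)`. -/
def dist (P : Problem d m S) {n : ℕ} (θn : DiscreteParam d m n) (θ : ContParam d m) : ℝ :=
  distL2 P.normdd (extend θn.K) θ.K + distL2 P.normd (extend θn.b) θ.b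
    + P.normmd (θn.W - θ.W) + P.normm (θn.c - θ.c)

/-- `θ` minimises the objective functional of the network with `n` layers. -/
def IsMinimiser (P : Problem d m S) (n : ℕ) (θ : DiscreteParam d m n) : Prop :=
  ∀ θ' : DiscreteParam d m n, P.energy n θ ≤ P.energy n θ'

/-- `θ` minimises the limiting objective functional. -/
def IsLimitMinimiser (P : Problem d m S) (θ : ContParam d m) : Prop :=
  ∀ θ' : ContParam d m, P.limitEnergy θ ≤ P.limitEnergy θ'

end Problem

end Params

end DeepResNet

end

/-!
The functionals `𝓔_n` Γ-converge to `𝓔_∞`, with compactness of sequences of bounded energy, and the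
theorem is the usual consequence of these two facts. Pointwise convergence on `[0,1)` of the
piecewise constant extensions, together with a bound on the parameters, serves as the notion of
convergence; it implies convergence for the discrete-to-continuum distance
(`Admissible.tendsto_dist`).

*Compactness and lower bound.* For a discrete function `u` on `n` layers, the step function with
values `n (u_{i+1} - u_i)` has an `L²` norm whose square is exactly `n ∑ ‖u_i - u_{i-1}‖²`, and its
primitive differs from the piecewise constant extension of `u` by `O(n^{-1/2})`. A bound on the
energy therefore makes these step functions bounded in `L²`, so that a subsequence converges weakly
to some `g`. Testing with indicator functions of intervals `(0,t]` yields pointwise convergence of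
the extensions to `f(t) = f(0) + ∫₀ᵗ g`, an element of `H¹` with derivative `g`. The norm on the
values is arbitrary, so the lower bound `∫ ‖g‖² ≤ liminf` is obtained from the fact that closed
convex sets are weakly closed (`exists_subseq_tendsto_primitive`, `exists_subseq_tendsto_extend`).

*Upper bound.* Sampling a parameter of `Θ` on the grid does not increase the regularising terms, by
the Cauchy–Schwarz inequality on each grid interval (`discreteReg_sample_le`). This uses that an
`H¹` function is the primitive of its weak derivative, that is, du Bois-Reymond's lemma
(`IsWeakDeriv.eq_of_zero`, `MemH1.eq_primitive`).

*The states.* The networks are Euler schemes for the differential equation. A discrete Grönwall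
estimate bounds the distance between the last state and the exact solution by the integral of a
local error, which tends to zero by dominated convergence (`Problem.norm_state_sub_le`,
`Problem.tendsto_state`). The solution on all of `[0,1]` exists because the field is globally
Lipschitz in space.

Existence of a minimiser of `𝓔_∞` is a by-product: it is a limit of minimisers of the `𝓔_n`, which
exist by continuity and coercivity on a finite-dimensional space.
-/

noncomputable section

namespace DeepResNet

/-! ### Weak derivatives on the unit interval -/

section WeakDerivatives

variable {V : Type*} [NormedAddCommGroup V]

theorem memLp_two_intervalIntegrable {g : ℝ → V}
    (hg : MemLp g 2 (volume.restrict (Icc (0 : ℝ) 1))) {a b : ℝ} (ha : a ∈ Icc (0 : ℝ) 1)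
    (hb : b ∈ Icc (0 : ℝ) 1) : IntervalIntegrable g volume a b := by
  have h1 : IntegrableOn g (Icc (0 : ℝ) 1) := hg.integrable one_le_two
  have h2 : IntervalIntegrable g volume 0 1 :=
    (intervalIntegrable_iff_integrableOn_Icc_of_le zero_le_one).2 h1
  refine h2.mono_set (uIcc_subset_uIcc ?_ ?_) <;> rwa [uIcc_of_le zero_le_one]

variable [NormedSpace ℝ V]

theorem continuousOn_primitive_of_memLp_two {g : ℝ → V}
    (hg : MemLp g 2 (volume.restrict (Icc (0 : ℝ) 1))) :
    ContinuousOn (fun t => ∫ s in (0 : ℝ)..t, g s) (Icc 0 1) := by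
  have := intervalIntegral.continuousOn_primitive_interval
    (μ := volume) (f := g) (a := 0) (b := 1) (by
      rw [uIcc_of_le zero_le_one]; exact hg.integrable one_le_two)
  rwa [uIcc_of_le zero_le_one] at this

theorem eq_zero_of_tsupport_subset {φ : ℝ → ℝ} (hφ : tsupport φ ⊆ Ioo (0 : ℝ) 1) {t : ℝ}
    (ht : t ∉ Ioo (0 : ℝ) 1) : φ t = 0 :=
  image_eq_zero_of_notMem_tsupport fun h => ht (hφ h)

/-- Integration by parts for a primitive of a scalar integrable function: both factors are
absolutely continuous. -/
theorem integral_deriv_mul_primitive {g φ : ℝ → ℝ} (hg : IntervalIntegrable g volume 0 1)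
    (hφ : ContDiff ℝ ∞ φ) (hφs : tsupport φ ⊆ Ioo (0 : ℝ) 1) :
    ∫ t in (0 : ℝ)..1, deriv φ t * ∫ s in (0 : ℝ)..t, g s = -∫ t in (0 : ℝ)..1, φ t * g t := by
  have hF := hg.absolutelyContinuousOnInterval_intervalIntegral (c := 0) (by simp)
  have hΦ : AbsolutelyContinuousOnInterval φ 0 1 := by
    obtain ⟨C, hC⟩ := (hφ.of_le (by simp : (1 : WithTop ℕ∞) ≤ ∞)).contDiffOn
      |>.exists_lipschitzOnWith (s := uIcc (0 : ℝ) 1) (by simp) (convex_uIcc 0 1) isCompact_uIcc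
    exact hC.absolutelyContinuousOnInterval
  have h := hΦ.integral_mul_deriv_eq_deriv_mul hF
  rw [eq_zero_of_tsupport_subset hφs (by simp), eq_zero_of_tsupport_subset hφs (by simp)] at h
  have h2 : ∫ t in (0 : ℝ)..1, φ t * deriv (fun x => ∫ v in (0 : ℝ)..x, g v) t
      = ∫ t in (0 : ℝ)..1, φ t * g t := by
    apply intervalIntegral.integral_congr_ae
    filter_upwards [hg.ae_hasDerivAt_integral] with x hx hx1
    rw [(hx (uIoc_subset_uIcc hx1) 0 (by simp)).deriv]
  rw [← h2, h]
  ring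

theorem isWeakDeriv_of_eq_primitive [CompleteSpace V] {f g : ℝ → V} {v : V}
    (hg : IntervalIntegrable g volume 0 1)
    (hf : ∀ t ∈ Icc (0 : ℝ) 1, f t = v + ∫ s in (0 : ℝ)..t, g s) : IsWeakDeriv f g := by
  intro φ hφ _ hφs
  have hφ' : Continuous (deriv φ) := hφ.continuous_deriv (by simp)
  have hprim : ContinuousOn (fun t => ∫ s in (0 : ℝ)..t, g s) (uIcc 0 1) :=
    intervalIntegral.continuousOn_primitive_interval
      ((intervalIntegrable_iff' (by simp)).1 hg)
  have hfc : ContinuousOn f (uIcc 0 1) := by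
    rw [uIcc_of_le zero_le_one] at *
    exact (continuousOn_const.add hprim).congr hf
  refine SeparatingDual.eq_iff_forall_dual_eq (R := ℝ) |>.2 fun ℓ => ?_
  have i1 : IntervalIntegrable (fun t => deriv φ t • f t) volume 0 1 :=
    (hφ'.continuousOn.smul hfc).intervalIntegrable
  have i2 : IntervalIntegrable (fun t => φ t • g t) volume 0 1 :=
    hg.continuousOn_smul hφ.continuous.continuousOn
  have hℓg : IntervalIntegrable (fun t => ℓ (g t)) volume 0 1 :=
    ⟨ℓ.integrable_comp hg.1, ℓ.integrable_comp hg.2⟩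
  rw [map_neg, ← ℓ.intervalIntegral_comp_comm i1, ← ℓ.intervalIntegral_comp_comm i2]
  simp only [map_smul, smul_eq_mul]
  rw [← integral_deriv_mul_primitive hℓg hφ hφs]
  have e1 : ∫ t in (0 : ℝ)..1, deriv φ t * ℓ (f t)
      = ∫ t in (0 : ℝ)..1, (deriv φ t * ℓ v + deriv φ t * ∫ s in (0 : ℝ)..t, ℓ (g s)) := by
    apply intervalIntegral.integral_congr
    intro t ht
    rw [uIcc_of_le zero_le_one] at ht
    have hgt : IntervalIntegrable g volume 0 t :=
      hg.mono_set (uIcc_subset_uIcc (by simp) (by rwa [uIcc_of_le zero_le_one]))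
    simp only [hf t ht, map_add, ← ℓ.intervalIntegral_comp_comm hgt, mul_add]
  have hprim2 : ContinuousOn (fun t => ∫ s in (0 : ℝ)..t, ℓ (g s)) (uIcc 0 1) :=
    intervalIntegral.continuousOn_primitive_interval ((intervalIntegrable_iff' (by simp)).1 hℓg)
  have i3 : IntervalIntegrable (fun t => deriv φ t * ℓ v) volume 0 1 :=
    (hφ'.mul continuous_const).intervalIntegrable 0 1
  have i4 : IntervalIntegrable (fun t => deriv φ t * ∫ s in (0 : ℝ)..t, ℓ (g s)) volume 0 1 :=
    (hφ'.continuousOn.mul hprim2).intervalIntegrable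
  rw [e1, intervalIntegral.integral_add i3 i4, intervalIntegral.integral_mul_const,
    intervalIntegral.integral_deriv_eq_sub (fun x _ => hφ.differentiable (by simp) x)
      (hφ'.intervalIntegrable 0 1),
    eq_zero_of_tsupport_subset hφs (by simp), eq_zero_of_tsupport_subset hφs (by simp)]
  simp

theorem intervalIntegral_eq_integral_of_tsupport_subset {φ : ℝ → ℝ} (f : ℝ → V)
    (hφs : tsupport φ ⊆ Ioo (0 : ℝ) 1) :
    ∫ t in (0 : ℝ)..1, φ t • f t = ∫ t, φ t • f t := by
  rw [intervalIntegral.integral_of_le zero_le_one]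
  refine setIntegral_eq_integral_of_forall_compl_eq_zero fun t ht => ?_
  rw [eq_zero_of_tsupport_subset hφs fun h => ht (Ioo_subset_Ioc_self h), zero_smul]

/-- Weak derivatives are unique up to null sets. -/
theorem IsWeakDeriv.ae_eq [CompleteSpace V] {f g₁ g₂ : ℝ → V}
    (h₁ : IsWeakDeriv f g₁) (h₂ : IsWeakDeriv f g₂)
    (hg₁ : IntegrableOn g₁ (Icc (0 : ℝ) 1)) (hg₂ : IntegrableOn g₂ (Icc (0 : ℝ) 1)) :
    ∀ᵐ t, t ∈ Ioo (0 : ℝ) 1 → g₁ t = g₂ t := by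
  have hi : IntegrableOn (fun t => g₁ t - g₂ t) (Icc (0 : ℝ) 1) := hg₁.sub hg₂
  have key := isOpen_Ioo.ae_eq_zero_of_integral_contDiff_smul_eq_zero (U := Ioo (0 : ℝ) 1)
    (μ := volume) (f := fun t => g₁ t - g₂ t)
    ((hi.mono_set Ioo_subset_Icc_self).locallyIntegrableOn) (by
      intro φ hφ hφc hφs
      have i1 : IntervalIntegrable (fun t => φ t • g₁ t) volume 0 1 :=
        ((intervalIntegrable_iff_integrableOn_Icc_of_le zero_le_one).2 hg₁).continuousOn_smul
          hφ.continuous.continuousOn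
      have i2 : IntervalIntegrable (fun t => φ t • g₂ t) volume 0 1 :=
        ((intervalIntegrable_iff_integrableOn_Icc_of_le zero_le_one).2 hg₂).continuousOn_smul
          hφ.continuous.continuousOn
      have := (h₁ φ hφ hφc hφs).symm.trans (h₂ φ hφ hφc hφs)
      rw [← intervalIntegral_eq_integral_of_tsupport_subset _ hφs]
      simp only [smul_sub]
      rw [intervalIntegral.integral_sub i1 i2, neg_inj.1 this, sub_self])
  filter_upwards [key] with t ht h01 using sub_eq_zero.1 (ht h01)

/-- A test function on `(0,1)` of mean zero is the derivative of a test function on `(0,1)`. -/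
theorem exists_deriv_eq_of_integral_eq_zero {ψ : ℝ → ℝ} (hψ : ContDiff ℝ ∞ ψ)
    (hψc : HasCompactSupport ψ) (hψs : tsupport ψ ⊆ Ioo (0 : ℝ) 1) (h0 : ∫ t, ψ t = 0) :
    ∃ φ : ℝ → ℝ, ContDiff ℝ ∞ φ ∧ HasCompactSupport φ ∧ tsupport φ ⊆ Ioo (0 : ℝ) 1 ∧
      deriv φ = ψ := by
  have hcont : Continuous ψ := hψ.continuous
  -- the support of `ψ` lies in a compact interval `[a,b] ⊆ (0,1)`
  obtain ⟨a, b, ha, hb, hab⟩ : ∃ a b : ℝ, 0 < a ∧ b < 1 ∧ tsupport ψ ⊆ Icc a b := by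
    rcases (tsupport ψ).eq_empty_or_nonempty with he | hne
    · exact ⟨1, 0, one_pos, zero_lt_one, by simp [he]⟩
    · obtain ⟨a, ha⟩ := IsCompact.exists_isLeast hψc hne
      obtain ⟨b, hb⟩ := IsCompact.exists_isGreatest hψc hne
      exact ⟨a, b, (hψs ha.1).1, (hψs hb.1).2, fun t ht => ⟨ha.2 ht, hb.2 ht⟩⟩
  have hz : ∀ t, t ∉ Icc a b → ψ t = 0 := fun t ht =>
    image_eq_zero_of_notMem_tsupport fun h => ht (hab h)
  have hder : ∀ t, HasDerivAt (fun x => ∫ s in (0 : ℝ)..x, ψ s) (ψ t) t := fun t =>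
    intervalIntegral.integral_hasDerivAt_right (hcont.intervalIntegrable _ _)
      hcont.stronglyMeasurable.stronglyMeasurableAtFilter hcont.continuousAt
  have hderiv : deriv (fun x => ∫ s in (0 : ℝ)..x, ψ s) = ψ := funext fun t => (hder t).deriv
  have hsupp : ∀ t, t ∉ Icc a b → ∫ s in (0 : ℝ)..t, ψ s = 0 := by
    intro t ht
    rcases not_and_or.1 ht with h | h
    · push Not at h
      have : ∫ s in (0 : ℝ)..t, ψ s = ∫ s in (0 : ℝ)..t, (0 : ℝ) := by
        apply intervalIntegral.integral_congr
        intro s hs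
        refine hz s fun hs' => ?_
        rcases le_total 0 t with h1 | h1
        · rw [uIcc_of_le h1] at hs; exact absurd (hs'.1.trans hs.2) (not_le.2 h)
        · rw [uIcc_of_ge h1] at hs; exact absurd (hs'.1.trans hs.2) (not_le.2 ha)
      simpa using this
    · push Not at h
      by_cases hba : a ≤ b
      · rw [intervalIntegral.integral_of_le (ha.le.trans (hba.trans h.le))]
        refine Eq.trans ?_ h0
        refine setIntegral_eq_integral_of_forall_compl_eq_zero fun s hs => hz s fun hs' => hs ?_
        exact ⟨ha.trans_le hs'.1, hs'.2.trans h.le⟩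
      · have : ψ = 0 := funext fun s => hz s fun hs' => hba (hs'.1.trans hs'.2)
        simp [this]
  have hts : tsupport (fun x => ∫ s in (0 : ℝ)..x, ψ s) ⊆ Icc a b := by
    refine closure_minimal (fun t ht => ?_) isClosed_Icc
    by_contra h
    exact ht (hsupp t h)
  refine ⟨fun x => ∫ s in (0 : ℝ)..x, ψ s, ?_, ?_, ?_, hderiv⟩
  · rw [contDiff_infty_iff_deriv, hderiv]
    exact ⟨fun t => (hder t).differentiableAt, hψ⟩
  · exact isCompact_Icc.of_isClosed_subset (isClosed_tsupport _) hts
  · exact hts.trans fun t ht => ⟨ha.trans_le ht.1, ht.2.trans_lt hb⟩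

/-- Du Bois-Reymond's lemma: a continuous function with vanishing weak derivative is constant. -/
theorem IsWeakDeriv.eq_of_zero [CompleteSpace V] {h : ℝ → V}
    (hc : ContinuousOn h (Icc (0 : ℝ) 1)) (hw : IsWeakDeriv h 0) :
    ∀ t ∈ Icc (0 : ℝ) 1, h t = h 0 := by
  -- a fixed test function of integral one; every test function differs from a multiple of it by a
  -- derivative of a test function
  let η : ContDiffBump (1 / 2 : ℝ) := ⟨1 / 8, 1 / 4, by norm_num, by norm_num⟩
  have hηs : tsupport (η.normed volume) ⊆ Ioo (0 : ℝ) 1 := by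
    rw [η.tsupport_normed_eq, Real.closedBall_eq_Icc]
    intro t ht
    norm_num [η] at ht
    constructor <;> linarith [ht.1, ht.2]
  have hηd : ContDiff ℝ ∞ (η.normed volume) := η.contDiff_normed
  have hηc : HasCompactSupport (η.normed volume) := η.hasCompactSupport_normed
  have hηi : ∫ t, η.normed volume t = 1 := η.integral_normed
  set c : V := ∫ t in (0 : ℝ)..1, η.normed volume t • h t with hcdef
  have hcu : ContinuousOn h (uIcc (0 : ℝ) 1) := by rwa [uIcc_of_le zero_le_one]
  have key : ∀ᵐ t, t ∈ Ioo (0 : ℝ) 1 → h t - c = 0 := by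
    refine isOpen_Ioo.ae_eq_zero_of_integral_contDiff_smul_eq_zero
      (((hc.sub continuousOn_const).integrableOn_Icc.mono_set
        Ioo_subset_Icc_self).locallyIntegrableOn) ?_
    intro ψ hψ hψc hψs
    set m : ℝ := ∫ t, ψ t with hm
    have hψi : Integrable ψ := hψ.continuous.integrable_of_hasCompactSupport hψc
    have hηint : Integrable (η.normed volume) :=
      hηd.continuous.integrable_of_hasCompactSupport hηc
    have hts : tsupport (fun t => ψ t - m * η.normed volume t) ⊆ Ioo (0 : ℝ) 1 := by
      refine (tsupport_sub _ _).trans (union_subset hψs ?_)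
      exact (closure_mono (Function.support_const_smul_subset m (η.normed volume))).trans hηs
    obtain ⟨φ, hφ, hφc, hφs, hφd⟩ := exists_deriv_eq_of_integral_eq_zero
      (ψ := fun t => ψ t - m * η.normed volume t) (hψ.sub (contDiff_const.mul hηd))
      (hψc.sub hηc.mul_left) hts (by
        rw [integral_sub hψi (hηint.const_mul m), integral_const_mul, hηi, mul_one, sub_self])
    have hw' := hw φ hφ hφc hφs
    simp only [hφd, sub_smul, Pi.zero_apply, smul_zero, intervalIntegral.integral_zero, neg_zero,
      mul_smul] at hw'
    have i1 : IntervalIntegrable (fun t => ψ t • h t) volume 0 1 :=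
      (hψ.continuous.continuousOn.smul hcu).intervalIntegrable
    have i2 : IntervalIntegrable (fun t => η.normed volume t • h t) volume 0 1 :=
      (hηd.continuous.continuousOn.smul hcu).intervalIntegrable
    have i2' : IntervalIntegrable (fun t => m • η.normed volume t • h t) volume 0 1 := i2.smul m
    rw [intervalIntegral.integral_sub i1 i2', intervalIntegral.integral_smul,
      ← hcdef] at hw'
    rw [← intervalIntegral_eq_integral_of_tsupport_subset _ hψs]
    simp only [smul_sub]
    have i3 : IntervalIntegrable (fun t => ψ t • c) volume 0 1 :=
      (hψ.continuous.smul continuous_const).intervalIntegrable 0 1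
    rw [intervalIntegral.integral_sub i1 i3,
      intervalIntegral_eq_integral_of_tsupport_subset (fun _ => c) hψs,
      integral_smul_const, ← hm, ← hw']
  have hIoo : ∀ t ∈ Ioo (0 : ℝ) 1, h t = c := by
    have hae : h =ᵐ[volume.restrict (Ioo (0 : ℝ) 1)] fun _ => c := by
      rw [Filter.EventuallyEq, ae_restrict_iff' measurableSet_Ioo]
      filter_upwards [key] with t ht h01 using sub_eq_zero.1 (ht h01)
    exact Measure.eqOn_open_of_ae_eq hae isOpen_Ioo (hc.mono Ioo_subset_Icc_self)
      continuousOn_const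
  have hIcc : EqOn h (fun _ => c) (Icc 0 1) :=
    EqOn.of_subset_closure hIoo hc continuousOn_const Ioo_subset_Icc_self
      (by rw [closure_Ioo zero_ne_one])
  intro t ht
  rw [hIcc ht, hIcc (left_mem_Icc.2 zero_le_one)]

/-- A continuous function with a square-integrable weak derivative is a primitive of it. -/
theorem IsWeakDeriv.eq_primitive [CompleteSpace V] {f g : ℝ → V}
    (hf : ContinuousOn f (Icc (0 : ℝ) 1))
    (hg : MemLp g 2 (volume.restrict (Icc (0 : ℝ) 1))) (hw : IsWeakDeriv f g) :
    ∀ t ∈ Icc (0 : ℝ) 1, f t = f 0 + ∫ s in (0 : ℝ)..t, g s := by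
  have hgi : IntervalIntegrable g volume 0 1 := memLp_two_intervalIntegrable hg (by simp) (by simp)
  have hF : IsWeakDeriv (fun t => ∫ s in (0 : ℝ)..t, g s) g :=
    isWeakDeriv_of_eq_primitive (v := 0) hgi (by simp)
  have hFc := continuousOn_primitive_of_memLp_two hg
  have h0 : IsWeakDeriv (fun t => f t - ∫ s in (0 : ℝ)..t, g s) 0 := by
    intro φ hφ hφc hφs
    have hφ' : Continuous (deriv φ) := hφ.continuous_deriv (by simp)
    have i1 : IntervalIntegrable (fun t => deriv φ t • f t) volume 0 1 :=
      ContinuousOn.intervalIntegrable (by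
        rw [uIcc_of_le zero_le_one]; exact hφ'.continuousOn.smul hf)
    have i2 : IntervalIntegrable (fun t => deriv φ t • ∫ s in (0 : ℝ)..t, g s) volume 0 1 :=
      ContinuousOn.intervalIntegrable (by
        rw [uIcc_of_le zero_le_one]; exact hφ'.continuousOn.smul hFc)
    simp only [smul_sub]
    rw [intervalIntegral.integral_sub i1 i2, hw φ hφ hφc hφs, hF φ hφ hφc hφs]
    simp
  intro t ht
  have : f t - ∫ s in (0 : ℝ)..t, g s = f 0 - ∫ s in (0 : ℝ)..0, g s :=
    h0.eq_of_zero (hf.sub hFc) t ht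
  rw [intervalIntegral.integral_same, sub_zero] at this
  rw [← this, sub_add_cancel]

theorem HasL2WeakDeriv.weakDeriv_spec {f : ℝ → V} (h : HasL2WeakDeriv f) :
    MemLp (weakDeriv f) 2 (volume.restrict (Icc (0 : ℝ) 1)) ∧ IsWeakDeriv f (weakDeriv f) := by
  rw [weakDeriv, dif_pos h]
  exact h.choose_spec

theorem memH1_of_eq_primitive [CompleteSpace V] {f g : ℝ → V} {v : V}
    (hg : MemLp g 2 (volume.restrict (Icc (0 : ℝ) 1)))
    (hf : ∀ t ∈ Icc (0 : ℝ) 1, f t = v + ∫ s in (0 : ℝ)..t, g s) : MemH1 f :=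
  ⟨(continuousOn_const.add (continuousOn_primitive_of_memLp_two hg)).congr hf, g, hg,
    isWeakDeriv_of_eq_primitive (memLp_two_intervalIntegrable hg (by simp) (by simp)) hf⟩

theorem weakDeriv_ae_eq_of_eq_primitive [CompleteSpace V] {f g : ℝ → V} {v : V}
    (hg : MemLp g 2 (volume.restrict (Icc (0 : ℝ) 1)))
    (hf : ∀ t ∈ Icc (0 : ℝ) 1, f t = v + ∫ s in (0 : ℝ)..t, g s) :
    ∀ᵐ t, t ∈ Ioo (0 : ℝ) 1 → weakDeriv f t = g t := by
  obtain ⟨h1, h2⟩ := (memH1_of_eq_primitive hg hf).hasL2WeakDeriv.weakDeriv_spec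
  exact h2.ae_eq (isWeakDeriv_of_eq_primitive
    (memLp_two_intervalIntegrable hg (by simp) (by simp)) hf)
    (h1.integrable one_le_two) (hg.integrable one_le_two)

theorem MemH1.eq_primitive [CompleteSpace V] {f : ℝ → V} (hf : MemH1 f) :
    ∀ t ∈ Icc (0 : ℝ) 1, f t = f 0 + ∫ s in (0 : ℝ)..t, weakDeriv f s :=
  hf.hasL2WeakDeriv.weakDeriv_spec.2.eq_primitive hf.continuousOn
    hf.hasL2WeakDeriv.weakDeriv_spec.1

/-- The derivative chosen in `weakDeriv` may be replaced by any square-integrable density of `f`. -/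
theorem Problem.contReg_of_eq_primitive [CompleteSpace V] {f g : ℝ → V} {v : V}
    (N : Seminorm ℝ V) (τ : ℝ)
    (hg : MemLp g 2 (volume.restrict (Icc (0 : ℝ) 1)))
    (hf : ∀ t ∈ Icc (0 : ℝ) 1, f t = v + ∫ s in (0 : ℝ)..t, g s) :
    Problem.contReg N τ f = (∫ t in (0 : ℝ)..1, N (g t) ^ 2) + τ * N v ^ 2 := by
  have h0 : f 0 = v := by simpa using hf 0 (by simp)
  have h1 : ∫ t in (0 : ℝ)..1, N (weakDeriv f t) ^ 2 = ∫ t in (0 : ℝ)..1, N (g t) ^ 2 := by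
    apply intervalIntegral.integral_congr_ae
    filter_upwards [weakDeriv_ae_eq_of_eq_primitive hg hf, (measure_singleton (1 : ℝ) :
      volume {(1 : ℝ)} = 0) |> measure_eq_zero_iff_ae_notMem.1] with t ht ht1 ht01
    rw [uIoc_of_le zero_le_one] at ht01
    rw [ht ⟨ht01.1, lt_of_le_of_ne ht01.2 ht1⟩]
  rw [Problem.contReg, h1, h0]

end WeakDerivatives

/-! ### Definite seminorms in finite dimension -/

section DefiniteSeminorm

theorem exists_linearEquiv_norm_eq.{u} {V : Type u} [AddCommGroup V] [Module ℝ V]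
    (N : Seminorm ℝ V) (hN : ∀ v, N v = 0 → v = 0) :
    ∃ (E : Type u) (_ : NormedAddCommGroup E) (_ : NormedSpace ℝ E) (L : V ≃ₗ[ℝ] E),
      ∀ v, ‖L v‖ = N v := by
  let : Norm V := ⟨N⟩
  have core : NormedSpace.Core ℝ V :=
    { norm_nonneg := fun v => apply_nonneg N v
      norm_smul := fun c v => map_smul_eq_mul N c v
      norm_triangle := fun v w => map_add_le_add N v w
      norm_eq_zero_iff := fun v => ⟨hN v, fun h => h ▸ map_zero N⟩ }
  let grp : NormedAddCommGroup V := NormedAddCommGroup.ofCore core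
  exact ⟨V, grp, NormedSpace.ofCore core, LinearEquiv.refl ℝ V, fun _ => rfl⟩

/-- A definite seminorm on a finite-dimensional space is the norm of a linearly homeomorphic
normed space. -/
theorem exists_continuousLinearEquiv_norm_eq.{u} {V : Type u} [NormedAddCommGroup V]
    [NormedSpace ℝ V] [FiniteDimensional ℝ V] (N : Seminorm ℝ V) (hN : ∀ v, N v = 0 → v = 0) :
    ∃ (E : Type u) (_ : NormedAddCommGroup E) (_ : NormedSpace ℝ E) (L : V ≃L[ℝ] E),
      ∀ v, ‖L v‖ = N v := by
  obtain ⟨E, i1, i2, L, hL⟩ := exists_linearEquiv_norm_eq N hN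
  exact ⟨E, i1, i2, L.toContinuousLinearEquiv, hL⟩

variable {V : Type*} [NormedAddCommGroup V] [NormedSpace ℝ V] [FiniteDimensional ℝ V]

theorem continuous_of_definite (N : Seminorm ℝ V) (hN : ∀ v, N v = 0 → v = 0) : Continuous N := by
  obtain ⟨E, _, _, L, hL⟩ := exists_continuousLinearEquiv_norm_eq N hN
  have : (N : V → ℝ) = fun v => ‖L v‖ := funext fun v => (hL v).symm
  rw [this]
  exact L.continuous.norm

theorem exists_le_mul_norm (N : Seminorm ℝ V) (hN : ∀ v, N v = 0 → v = 0) :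
    ∃ C : ℝ, 0 ≤ C ∧ ∀ v, N v ≤ C * ‖v‖ := by
  obtain ⟨E, _, _, L, hL⟩ := exists_continuousLinearEquiv_norm_eq N hN
  exact ⟨‖(L : V →L[ℝ] E)‖, norm_nonneg _, fun v => hL v ▸ (L : V →L[ℝ] E).le_opNorm v⟩

theorem exists_norm_le_of_sq_le (N : Seminorm ℝ V) (hN : ∀ v, N v = 0 → v = 0) (A : ℝ) :
    ∃ R : ℝ, 0 ≤ R ∧ ∀ v, N v ^ 2 ≤ A → ‖v‖ ≤ R := by
  obtain ⟨E, _, _, L, hL⟩ := exists_continuousLinearEquiv_norm_eq N hN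
  refine ⟨‖(L.symm : E →L[ℝ] V)‖ * √A, by positivity, fun v hv => ?_⟩
  calc ‖v‖ = ‖(L.symm : E →L[ℝ] V) (L v)‖ := by simp
    _ ≤ ‖(L.symm : E →L[ℝ] V)‖ * ‖L v‖ := ContinuousLinearMap.le_opNorm _ _
    _ ≤ _ := by rw [hL]; gcongr; exact Real.le_sqrt_of_sq_le hv

end DefiniteSeminorm

/-! ### Weak compactness in `L²` -/

section WeakCompactness

/-- Bounded sequences in a separable Hilbert space have weakly convergent subsequences. -/
theorem exists_subseq_tendsto_inner {H : Type*} [NormedAddCommGroup H] [InnerProductSpace ℝ H]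
    [CompleteSpace H] [TopologicalSpace.SeparableSpace H] {x : ℕ → H} {R : ℝ}
    (hx : ∀ k, ‖x k‖ ≤ R) :
    ∃ ψ : ℕ → ℕ, StrictMono ψ ∧ ∃ y : H, ∀ z,
      Tendsto (fun k => inner ℝ (x (ψ k)) z) atTop (𝓝 (inner ℝ y z)) := by
  have hc := WeakDual.isSeqCompact_closedBall ℝ H 0 R
  obtain ⟨a, -, ψ, hψ, ha⟩ := @hc
    (fun k => StrongDual.toWeakDual (InnerProductSpace.toDual ℝ H (x k))) (by
      intro k
      simpa using hx k)
  refine ⟨ψ, hψ, (InnerProductSpace.toDual ℝ H).symm (WeakDual.toStrongDual a), fun z => ?_⟩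
  have := ((WeakDual.eval_continuous z).tendsto a).comp ha
  simpa [Function.comp_def] using this

/-- Closed convex sets are weakly sequentially closed (Hahn–Banach). -/
theorem mem_of_tendsto_inner {H : Type*} [NormedAddCommGroup H] [InnerProductSpace ℝ H]
    [CompleteSpace H] {x : ℕ → H} {y : H} {C : Set H} (hC : Convex ℝ C) (hCc : IsClosed C)
    (hxy : ∀ z, Tendsto (fun k => inner ℝ (x k) z) atTop (𝓝 (inner ℝ y z)))
    (hx : ∃ᶠ k in atTop, x k ∈ C) : y ∈ C := by
  by_contra hy
  obtain ⟨ℓ, u, hu, hlt⟩ := geometric_hahn_banach_point_closed hC hCc hy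
  have hℓ : ∀ w, ℓ w = inner ℝ w ((InnerProductSpace.toDual ℝ H).symm ℓ) := fun w => by
    rw [real_inner_comm, InnerProductSpace.toDual_symm_apply]
  have := (hxy ((InnerProductSpace.toDual ℝ H).symm ℓ)).eventually_lt_const (hℓ y ▸ hu)
  obtain ⟨k, hk, hk'⟩ := (hx.and_eventually this).exists
  exact absurd (hlt _ hk) (by rw [hℓ]; exact not_lt.2 hk'.le)

theorem tendsto_euclideanSpace_of_tendsto_inner {ι : Type*} [Fintype ι]
    {x : ℕ → EuclideanSpace ℝ ι} {y : EuclideanSpace ℝ ι}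
    (h : ∀ c, Tendsto (fun k => inner ℝ c (x k)) atTop (𝓝 (inner ℝ c y))) :
    Tendsto x atTop (𝓝 y) := by
  classical
  rw [(PiLp.homeomorph 2 (fun _ : ι => ℝ)).isInducing.tendsto_nhds_iff, tendsto_pi_nhds]
  intro i
  have hi := h (EuclideanSpace.single i (1 : ℝ))
  simp only [EuclideanSpace.inner_single_left, map_one, one_mul] at hi
  exact hi

theorem norm_toLp_sq {E : Type*} [NormedAddCommGroup E] {g : ℝ → E}
    (hg : MemLp g 2 (volume.restrict (Icc (0 : ℝ) 1))) :
    ‖hg.toLp g‖ ^ 2 = ∫ t in (0 : ℝ)..1, ‖g t‖ ^ 2 := by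
  rw [Lp.norm_toLp, hg.eLpNorm_eq_integral_rpow_norm (by simp) (by simp),
    ENNReal.toReal_ofReal (by positivity), intervalIntegral.integral_of_le zero_le_one,
    ← integral_Icc_eq_integral_Ioc]
  simp only [ENNReal.toReal_ofNat, Real.rpow_ofNat]
  rw [← Real.rpow_natCast, ← Real.rpow_mul (integral_nonneg fun _ => by positivity)]
  norm_num

/-- Weak compactness in `L²(0,1)` for functions with values in a finite-dimensional space `V`:
the primitives of a bounded sequence converge pointwise along a subsequence, and the squared norm
of `L²`, taken with respect to any norm `‖L ·‖` on `V`, is lower semicontinuous. -/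
theorem exists_subseq_tendsto_primitive {V E : Type*} [NormedAddCommGroup V] [NormedSpace ℝ V]
    [FiniteDimensional ℝ V] [NormedAddCommGroup E] [NormedSpace ℝ E] (L : V ≃L[ℝ] E)
    {g : ℕ → ℝ → V} (hg : ∀ k, MemLp (g k) 2 (volume.restrict (Icc (0 : ℝ) 1))) {A : ℝ}
    (hA : ∀ k, ∫ t in (0 : ℝ)..1, ‖L (g k t)‖ ^ 2 ≤ A) :
    ∃ ψ : ℕ → ℕ, StrictMono ψ ∧ ∃ G : ℝ → V, MemLp G 2 (volume.restrict (Icc (0 : ℝ) 1)) ∧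
      (∀ t ∈ Icc (0 : ℝ) 1, Tendsto (fun k => ∫ s in (0 : ℝ)..t, g (ψ k) s) atTop
        (𝓝 (∫ s in (0 : ℝ)..t, G s))) ∧
      ∀ a, (∃ᶠ k in atTop, ∫ t in (0 : ℝ)..1, ‖L (g (ψ k) t)‖ ^ 2 ≤ a) →
        ∫ t in (0 : ℝ)..1, ‖L (G t)‖ ^ 2 ≤ a := by
  set μ := volume.restrict (Icc (0 : ℝ) 1) with hμ
  -- Euclidean coordinates turn the `L²` space into a Hilbert space
  let e : V ≃L[ℝ] EuclideanSpace ℝ (Fin (Module.finrank ℝ V)) := toEuclidean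
  let H := EuclideanSpace ℝ (Fin (Module.finrank ℝ V))
  have hge : ∀ k, MemLp (fun t => e (g k t)) 2 μ := fun k =>
    (e : V →L[ℝ] H).comp_memLp' (hg k)
  have hgL : ∀ k, MemLp (fun t => L (g k t)) 2 μ := fun k => (L : V →L[ℝ] E).comp_memLp' (hg k)
  let M : H →L[ℝ] E := (L : V →L[ℝ] E).comp (e.symm : H →L[ℝ] V)
  let x : ℕ → Lp H 2 μ := fun k => (hge k).toLp _
  have hMx : ∀ k, ‖M.compLpL 2 μ (x k)‖ ^ 2 = ∫ t in (0 : ℝ)..1, ‖L (g k t)‖ ^ 2 := by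
    intro k
    rw [← norm_toLp_sq (hgL k)]
    congr 2
    refine Lp.ext ?_
    filter_upwards [M.coeFn_compLpL (p := 2) (μ := μ) (x k), (hge k).coeFn_toLp,
      (hgL k).coeFn_toLp] with t h1 h2 h3
    rw [h1, h2, h3]
    simp [M]
  -- boundedness with respect to the Euclidean norm
  have hbd : ∀ k, ‖x k‖ ≤ ‖(e : V →L[ℝ] H).comp (L.symm : E →L[ℝ] V)‖ * √A := by
    intro k
    have hAk : ‖M.compLpL 2 μ (x k)‖ ≤ √A := Real.le_sqrt_of_sq_le ((hMx k).trans_le (hA k))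
    have : x k = ((e : V →L[ℝ] H).comp (L.symm : E →L[ℝ] V)).compLp (M.compLpL 2 μ (x k)) := by
      refine Lp.ext ?_
      filter_upwards [M.coeFn_compLpL (p := 2) (μ := μ) (x k), ((e : V →L[ℝ] H).comp
        (L.symm : E →L[ℝ] V)).coeFn_compLp (M.compLpL 2 μ (x k))] with t h1 h2
      rw [h2, h1]
      simp [M]
    calc ‖x k‖ ≤ _ := by
          conv_lhs => rw [this]
          exact ContinuousLinearMap.norm_compLp_le _ _
      _ ≤ _ := mul_le_mul_of_nonneg_left hAk (norm_nonneg _)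
  have : Fact ((2 : ENNReal) ≠ ⊤) := ⟨by simp⟩
  obtain ⟨ψ, hψ, y, hy⟩ := exists_subseq_tendsto_inner hbd
  have hyM : MemLp (fun t => e.symm (y t)) 2 μ := (e.symm : H →L[ℝ] V).comp_memLp' (Lp.memLp y)
  have hyL : MemLp (fun t => L (e.symm (y t))) 2 μ := (L : V →L[ℝ] E).comp_memLp' hyM
  refine ⟨ψ, hψ, fun t => e.symm (y t), hyM, fun t ht => ?_, fun a ha => ?_⟩
  · -- test with the indicator functions of `(0,t]` times constants
    have hres : ∀ f : ℝ → H, ∫ s in Ioc 0 t, f s ∂μ = ∫ s in (0 : ℝ)..t, f s := by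
      intro f
      rw [intervalIntegral.integral_of_le ht.1, hμ, Measure.restrict_restrict measurableSet_Ioc,
        inter_eq_left.2 (show Ioc 0 t ⊆ Icc 0 1 from fun s hs => ⟨hs.1.le, hs.2.trans ht.2⟩)]
    have hlim : Tendsto (fun k => ∫ s in (0 : ℝ)..t, e (g (ψ k) s)) atTop
        (𝓝 (∫ s in (0 : ℝ)..t, y s)) := by
      have h1 : ∀ c : H, Tendsto (fun k => inner ℝ c (∫ s in (0 : ℝ)..t, e (g (ψ k) s))) atTop
          (𝓝 (inner ℝ c (∫ s in (0 : ℝ)..t, y s))) := by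
        intro c
        have h2 := hy (indicatorConstLp 2 (measurableSet_Ioc (a := (0 : ℝ)) (b := t))
          (measure_ne_top μ _) c)
        have h3 : ∀ k, ∫ s in Ioc 0 t, x k s ∂μ = ∫ s in (0 : ℝ)..t, e (g k s) := by
          intro k
          rw [← hres]
          exact integral_congr_ae (ae_restrict_of_ae (hge k).coeFn_toLp)
        simp only [real_inner_comm (indicatorConstLp 2 _ _ c),
          L2.inner_indicatorConstLp_eq_inner_setIntegral, h3] at h2
        rwa [hres] at h2
      exact tendsto_euclideanSpace_of_tendsto_inner h1
    have := (e.symm.continuous.tendsto _).comp hlim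
    have h5 : ∀ k, e.symm (∫ s in (0 : ℝ)..t, e (g k s)) = ∫ s in (0 : ℝ)..t, g k s := by
      intro k
      rw [intervalIntegral.integral_of_le ht.1, intervalIntegral.integral_of_le ht.1]
      rw [← ContinuousLinearEquiv.integral_comp_comm]
      simp
    have h6 : e.symm (∫ s in (0 : ℝ)..t, y s) = ∫ s in (0 : ℝ)..t, e.symm (y s) := by
      rw [intervalIntegral.integral_of_le ht.1, intervalIntegral.integral_of_le ht.1]
      rw [← ContinuousLinearEquiv.integral_comp_comm]
    rw [h6] at this
    simpa only [Function.comp_def, h5] using this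
  · -- the sublevel set is a closed convex subset of `L²`
    have hmem : y ∈ M.compLpL 2 μ ⁻¹' Metric.closedBall 0 (√a) := by
      refine mem_of_tendsto_inner
        ((convex_closedBall (0 : Lp E 2 μ) (√a)).linear_preimage (M.compLpL 2 μ).toLinearMap)
        (Metric.isClosed_closedBall.preimage (M.compLpL 2 μ).continuous) hy (ha.mono fun k hk => ?_)
      rw [mem_preimage, mem_closedBall_zero_iff]
      exact Real.le_sqrt_of_sq_le ((hMx _).trans_le hk)
    have ha0 : 0 ≤ a := by
      obtain ⟨k, hk⟩ := ha.exists
      exact (intervalIntegral.integral_nonneg zero_le_one fun _ _ => by positivity).trans hk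
    rw [mem_preimage, mem_closedBall_zero_iff] at hmem
    have hyy : M.compLpL 2 μ y = hyL.toLp _ := by
      refine Lp.ext ?_
      filter_upwards [M.coeFn_compLpL (p := 2) (μ := μ) y, hyL.coeFn_toLp] with t h1 h2
      rw [h1, h2]
      simp [M]
    rw [hyy] at hmem
    rw [← norm_toLp_sq hyL]
    exact (Real.le_sqrt (norm_nonneg _) ha0).1 hmem

end WeakCompactness

/-! ### Step functions on a uniform grid -/

section StepFunctions

variable {V : Type*} [NormedAddCommGroup V]

/-- `⌊n t⌋₊` is the index of the grid interval `[i/n, (i+1)/n)` containing `t`. -/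
theorem natFloor_mul_eq {n i : ℕ} (hn : 1 ≤ n) {t : ℝ} (h1 : (i : ℝ) / n ≤ t)
    (h2 : t < (i + 1 : ℝ) / n) : ⌊(n : ℝ) * t⌋₊ = i := by
  have hn0 : (0 : ℝ) < n := by exact_mod_cast hn
  rw [div_le_iff₀ hn0] at h1
  rw [lt_div_iff₀ hn0] at h2
  refine (Nat.floor_eq_iff (by nlinarith [(Nat.cast_nonneg i : (0 : ℝ) ≤ i)])).2 ⟨?_, ?_⟩ <;>
    linarith

theorem natFloor_mul_lt {n : ℕ} {t : ℝ} (hn : 1 ≤ n) (ht : t < 1) : ⌊(n : ℝ) * t⌋₊ < n := by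
  have hn0 : (0 : ℝ) < n := by exact_mod_cast hn
  rw [Nat.floor_lt' (by omega)]
  nlinarith

theorem natFloor_mul_div_mem {n : ℕ} {t : ℝ} (hn : 1 ≤ n) (ht : 0 ≤ t) :
    (⌊(n : ℝ) * t⌋₊ : ℝ) / n ≤ t ∧ t < ((⌊(n : ℝ) * t⌋₊ : ℝ) + 1) / n := by
  have hn0 : (0 : ℝ) < n := by exact_mod_cast hn
  rw [div_le_iff₀ hn0, lt_div_iff₀ hn0]
  constructor
  · linarith [Nat.floor_le (mul_nonneg hn0.le ht)]
  · linarith [Nat.lt_floor_add_one ((n : ℝ) * t)]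

theorem stronglyMeasurable_comp_natFloor (F : ℕ → V) (n : ℕ) :
    StronglyMeasurable fun t : ℝ => F ⌊(n : ℝ) * t⌋₊ :=
  (StronglyMeasurable.of_discrete (f := F)).comp_measurable
    (Nat.measurable_floor.comp (measurable_const.mul measurable_id))

theorem norm_comp_natFloor_le (F : ℕ → V) (n : ℕ) {t : ℝ} (ht : t ≤ 1) :
    ‖F ⌊(n : ℝ) * t⌋₊‖ ≤ ∑ i ∈ Finset.range (n + 1), ‖F i‖ := by
  refine Finset.single_le_sum (f := fun i => ‖F i‖) (fun _ _ => norm_nonneg _) ?_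
  rw [Finset.mem_range, Nat.lt_succ_iff]
  refine Nat.floor_le_of_le ?_
  nlinarith [(Nat.cast_nonneg n : (0 : ℝ) ≤ n)]

theorem memLp_two_comp_natFloor (F : ℕ → V) (n : ℕ) :
    MemLp (fun t : ℝ => F ⌊(n : ℝ) * t⌋₊) 2 (volume.restrict (Icc (0 : ℝ) 1)) := by
  refine MemLp.of_bound (stronglyMeasurable_comp_natFloor F n).aestronglyMeasurable
    (∑ i ∈ Finset.range (n + 1), ‖F i‖) ?_
  filter_upwards [ae_restrict_mem measurableSet_Icc] with t ht
  exact norm_comp_natFloor_le F n ht.2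

theorem integral_comp_natFloor_of_mem [NormedSpace ℝ V] [CompleteSpace V] (F : ℕ → V) {n i : ℕ}
    (hn : 1 ≤ n) {a b : ℝ} (hab : a ≤ b) (ha : (i : ℝ) / n ≤ a) (hb : b ≤ (i + 1 : ℝ) / n) :
    ∫ t in a..b, F ⌊(n : ℝ) * t⌋₊ = (b - a) • F i := by
  rw [← intervalIntegral.integral_const]
  -- at the right end point the step function may already have jumped
  refine intervalIntegral.integral_congr_ae ?_
  filter_upwards [measure_eq_zero_iff_ae_notMem.1 (measure_singleton b : volume {b} = 0)]
    with t htb ht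
  rw [uIoc_of_le hab] at ht
  rw [natFloor_mul_eq hn (ha.trans ht.1.le) ((lt_of_le_of_ne ht.2 htb).trans_le hb)]

theorem integral_comp_natFloor [NormedSpace ℝ V] [CompleteSpace V] (F : ℕ → V) {n j : ℕ}
    (hn : 1 ≤ n) (hj : j ≤ n) :
    ∫ t in (0 : ℝ)..(j : ℝ) / n, F ⌊(n : ℝ) * t⌋₊
      = (1 / (n : ℝ)) • ∑ i ∈ Finset.range j, F i := by
  have hn0 : (0 : ℝ) < n := by exact_mod_cast hn
  have hmem : ∀ k : ℕ, k ≤ n → (k : ℝ) / n ∈ Icc (0 : ℝ) 1 := fun k hk =>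
    ⟨by positivity, (div_le_one hn0).2 (by exact_mod_cast hk)⟩
  have h := intervalIntegral.sum_integral_adjacent_intervals (μ := volume)
    (f := fun t : ℝ => F ⌊(n : ℝ) * t⌋₊) (a := fun k : ℕ => (k : ℝ) / n) (n := j)
    (fun k hk => memLp_two_intervalIntegrable (memLp_two_comp_natFloor F n)
      (hmem k (by omega)) (hmem (k + 1) (by omega)))
  simp only [Nat.cast_zero, zero_div] at h
  rw [← h, Finset.smul_sum]
  refine Finset.sum_congr rfl fun i _ => ?_
  rw [integral_comp_natFloor_of_mem F hn (i := i) (by push_cast; gcongr; linarith) le_rfl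
    (by push_cast; exact le_rfl)]
  congr 1
  push_cast
  ring

end StepFunctions

/-! ### Discrete functions of bounded regularisation -/

section DiscreteFunctions

variable {V : Type*} [NormedAddCommGroup V] [NormedSpace ℝ V]

/-- The discrete Dirichlet energy `n ∑_{i=1}^{n-1} ‖u_i - u_{i-1}‖²`. -/
def discreteDirichlet (N : Seminorm ℝ V) {n : ℕ} (u : Fin n → V) : ℝ :=
  (n : ℝ) * ∑ i ∈ Finset.Ico 1 n, N (layer u i - layer u (i - 1)) ^ 2

/-- The values of the difference quotients of `u`; the last layer has no successor and gets the
value `0`. -/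
def forwardDiff {n : ℕ} (u : Fin n → V) (i : ℕ) : V :=
  if i + 1 < n then (n : ℝ) • (layer u (i + 1) - layer u i) else 0

theorem discreteReg_eq (N : Seminorm ℝ V) (τ : ℝ) {n : ℕ} (u : Fin n → V) :
    Problem.discreteReg N τ u = discreteDirichlet N u + τ * N (layer u 0) ^ 2 := rfl

theorem discreteDirichlet_nonneg (N : Seminorm ℝ V) {n : ℕ} (u : Fin n → V) :
    0 ≤ discreteDirichlet N u :=
  mul_nonneg (Nat.cast_nonneg _) (Finset.sum_nonneg fun _ _ => sq_nonneg _)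

theorem discreteDirichlet_eq_sum_range (N : Seminorm ℝ V) {n : ℕ} (u : Fin n → V) :
    discreteDirichlet N u
      = n * ∑ i ∈ Finset.range (n - 1), N (layer u (i + 1) - layer u i) ^ 2 := by
  rw [discreteDirichlet, Finset.sum_Ico_eq_sum_range]
  simp [add_comm 1]

/-- The left-hand side is the squared `L²` norm of the step function with values `forwardDiff u`. -/
theorem sum_sq_forwardDiff (N : Seminorm ℝ V) {n : ℕ} (hn : 1 ≤ n) (u : Fin n → V) :
    (1 / (n : ℝ)) * ∑ i ∈ Finset.range n, N (forwardDiff u i) ^ 2 = discreteDirichlet N u := by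
  obtain ⟨m, rfl⟩ : ∃ m, n = m + 1 := ⟨n - 1, by omega⟩
  rw [discreteDirichlet_eq_sum_range, Finset.sum_range_succ, Finset.mul_sum, mul_add,
    Finset.mul_sum, Nat.add_sub_cancel]
  have hlast : N (forwardDiff u m) = 0 := by rw [forwardDiff, if_neg (by omega), map_zero]
  rw [hlast]
  simp only [ne_eq, OfNat.ofNat_ne_zero, not_false_eq_true, zero_pow, mul_zero, add_zero]
  refine Finset.sum_congr rfl fun i hi => ?_
  rw [Finset.mem_range] at hi
  rw [forwardDiff, if_pos (by omega), map_smul_eq_mul, Real.norm_natCast]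
  field_simp

theorem seminorm_layer_sub_le (N : Seminorm ℝ V) {n : ℕ} (u : Fin n → V) {j : ℕ} (hj : j < n) :
    N (layer u j - layer u 0) ≤ √(discreteDirichlet N u) := by
  have h1 : N (layer u j - layer u 0)
      ≤ ∑ i ∈ Finset.range j, N (layer u (i + 1) - layer u i) := by
    rw [← Finset.sum_range_sub (layer u) j]
    exact Finset.le_sum_of_subadditive N (map_zero N).le (map_add_le_add N) _ _
  refine h1.trans (Real.le_sqrt_of_sq_le (sq_sum_le_card_mul_sum_sq.trans ?_))
  rw [discreteDirichlet_eq_sum_range, Finset.card_range]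
  refine mul_le_mul (by exact_mod_cast hj.le) ?_ (Finset.sum_nonneg fun _ _ => sq_nonneg _)
    (Nat.cast_nonneg _)
  exact Finset.sum_le_sum_of_subset_of_nonneg
    (Finset.range_mono (by omega)) fun _ _ _ => sq_nonneg _

theorem seminorm_forwardDiff_le (N : Seminorm ℝ V) {n : ℕ} (u : Fin n → V) (j : ℕ) :
    N (forwardDiff u j) ≤ √(n * discreteDirichlet N u) := by
  rw [forwardDiff]
  split_ifs with hj
  · refine Real.le_sqrt_of_sq_le ?_
    rw [map_smul_eq_mul, Real.norm_natCast, mul_pow, sq, mul_assoc, discreteDirichlet_eq_sum_range]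
    gcongr
    exact Finset.single_le_sum (f := fun i => N (layer u (i + 1) - layer u i) ^ 2)
      (fun _ _ => sq_nonneg _) (Finset.mem_range.2 (by omega))
  · rw [map_zero]; positivity

/-- The piecewise constant extension differs from the primitive of the difference quotients by
`O(n^{-1/2})`. -/
theorem seminorm_extend_sub_le [CompleteSpace V] (N : Seminorm ℝ V) {n : ℕ} (hn : 1 ≤ n)
    (u : Fin n → V) {t : ℝ} (ht : t ∈ Ico (0 : ℝ) 1) :
    N (extend u t - (layer u 0 + ∫ s in (0 : ℝ)..t, forwardDiff u ⌊(n : ℝ) * s⌋₊))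
      ≤ √(discreteDirichlet N u / n) := by
  have hn0 : (0 : ℝ) < n := by exact_mod_cast hn
  set j := ⌊(n : ℝ) * t⌋₊ with hj
  have hjn : j < n := natFloor_mul_lt hn ht.2
  obtain ⟨hj1, hj2⟩ := natFloor_mul_div_mem hn ht.1
  rw [← hj] at hj1 hj2
  have hint : ∀ a ∈ Icc (0 : ℝ) 1, ∀ b ∈ Icc (0 : ℝ) 1,
      IntervalIntegrable (fun s : ℝ => forwardDiff u ⌊(n : ℝ) * s⌋₊) volume a b := fun a ha b hb =>
    memLp_two_intervalIntegrable (memLp_two_comp_natFloor _ n) ha hb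
  have hjm : (j : ℝ) / n ∈ Icc (0 : ℝ) 1 := ⟨by positivity, hj1.trans ht.2.le⟩
  have hsum : (1 / (n : ℝ)) • ∑ i ∈ Finset.range j, forwardDiff u i = layer u j - layer u 0 := by
    rw [← Finset.sum_range_sub (layer u) j, Finset.smul_sum]
    refine Finset.sum_congr rfl fun i hi => ?_
    rw [Finset.mem_range] at hi
    rw [forwardDiff, if_pos (by omega), smul_smul, one_div_mul_cancel hn0.ne', one_smul]
  rw [← intervalIntegral.integral_add_adjacent_intervals (hint 0 (by simp) _ hjm)
      (hint _ hjm t (Ico_subset_Icc_self ht)), integral_comp_natFloor _ hn hjn.le, hsum,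
    integral_comp_natFloor_of_mem _ hn hj1 le_rfl hj2.le]
  -- what remains is the part of the primitive between the grid point below `t` and `t`
  have : extend u t - (layer u 0 + (layer u j - layer u 0 + (t - (j : ℝ) / n) • forwardDiff u j))
      = -((t - (j : ℝ) / n) • forwardDiff u j) := by
    rw [extend, ← hj]; abel
  rw [this, map_neg_eq_map, map_smul_eq_mul, Real.norm_of_nonneg (sub_nonneg.2 hj1)]
  calc (t - (j : ℝ) / n) * N (forwardDiff u j) ≤ (1 / n) * √(n * discreteDirichlet N u) := by
        refine mul_le_mul ?_ (seminorm_forwardDiff_le N u j) (apply_nonneg N _) (by positivity)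
        rw [add_div] at hj2
        linarith
    _ = √(discreteDirichlet N u / n) := by
        rw [← Real.sqrt_sq (by positivity : (0 : ℝ) ≤ 1 / n), ← Real.sqrt_mul (by positivity)]
        congr 1
        field_simp

/-- Bounded regularisation bounds all the layers, uniformly in the number of layers. -/
theorem exists_norm_layer_le [FiniteDimensional ℝ V] (N : Seminorm ℝ V)
    (hN : ∀ v, N v = 0 → v = 0) {τ : ℝ} (hτ : 0 < τ) (A : ℝ) :
    ∃ R : ℝ, 0 ≤ R ∧ ∀ (n : ℕ) (u : Fin n → V), Problem.discreteReg N τ u ≤ A →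
      ∀ i, ‖layer u i‖ ≤ R := by
  obtain ⟨E, _, _, L, hL⟩ := exists_continuousLinearEquiv_norm_eq N hN
  refine ⟨‖(L.symm : E →L[ℝ] V)‖ * (√A + √(A / τ)), by positivity, fun n u hu i => ?_⟩
  have hpos := discreteDirichlet_nonneg N u
  rw [discreteReg_eq] at hu
  have h0 : N (layer u 0) ≤ √(A / τ) := by
    refine Real.le_sqrt_of_sq_le ?_
    rw [le_div_iff₀ hτ]
    linarith
  have hi : N (layer u i) ≤ √A + √(A / τ) := by
    by_cases hin : i < n
    · calc N (layer u i) = N ((layer u i - layer u 0) + layer u 0) := by rw [sub_add_cancel]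
        _ ≤ N (layer u i - layer u 0) + N (layer u 0) := map_add_le_add N _ _
        _ ≤ √A + √(A / τ) := by
          gcongr
          refine (seminorm_layer_sub_le N u hin).trans (Real.sqrt_le_sqrt ?_)
          nlinarith [sq_nonneg (N (layer u 0))]
    · rw [layer, dif_neg hin, map_zero]; positivity
  calc ‖layer u i‖ = ‖(L.symm : E →L[ℝ] V) (L (layer u i))‖ := by simp
    _ ≤ ‖(L.symm : E →L[ℝ] V)‖ * ‖L (layer u i)‖ := ContinuousLinearMap.le_opNorm _ _
    _ ≤ _ := by rw [hL]; gcongr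

/-- Compactness and lower semicontinuity: a sequence of discrete functions with bounded
regularisation converges pointwise along a subsequence to a function in `H¹`, whose regularisation
is at most the limit of the discrete ones. -/
theorem exists_subseq_tendsto_extend [FiniteDimensional ℝ V] (N : Seminorm ℝ V)
    (hN : ∀ v, N v = 0 → v = 0) {τ : ℝ} (hτ : 0 < τ) {n : ℕ → ℕ} (hn : ∀ k, 1 ≤ n k)
    (hnt : Tendsto n atTop atTop) (u : ∀ k, Fin (n k) → V) {A : ℝ}
    (hA : ∀ k, Problem.discreteReg N τ (u k) ≤ A) :
    ∃ ψ : ℕ → ℕ, StrictMono ψ ∧ ∃ f : ℝ → V, MemH1 f ∧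
      (∀ t ∈ Ico (0 : ℝ) 1, Tendsto (fun k => extend (u (ψ k)) t) atTop (𝓝 (f t))) ∧
      ∃ r, Tendsto (fun k => Problem.discreteReg N τ (u (ψ k))) atTop (𝓝 r) ∧
        Problem.contReg N τ f ≤ r := by
  have hcomplete : CompleteSpace V := FiniteDimensional.complete ℝ V
  have hproper : ProperSpace V := FiniteDimensional.proper_real V
  obtain ⟨R, hR0, hR⟩ := exists_norm_layer_le N hN hτ A
  obtain ⟨E, _, _, L, hL⟩ := exists_continuousLinearEquiv_norm_eq N hN
  have hNc := continuous_of_definite N hN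
  have hD : ∀ k, discreteDirichlet N (u k) ≤ A := fun k => by
    have := hA k
    rw [discreteReg_eq] at this
    nlinarith [sq_nonneg (N (layer (u k) 0))]
  -- convergence of the initial values and of the Dirichlet energies
  obtain ⟨⟨v, D⟩, -, ψ₁, hψ₁, hlim₁⟩ := tendsto_subseq_of_bounded
    (s := Metric.closedBall (0 : V) R ×ˢ Icc (0 : ℝ) A)
    (Metric.isBounded_closedBall.prod (Metric.isBounded_Icc 0 A))
    (x := fun k => (layer (u k) 0, discreteDirichlet N (u k))) (fun k =>
      ⟨by simpa using hR _ (u k) (hA k) 0, discreteDirichlet_nonneg N _, hD k⟩)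
  have hv := (continuous_fst.tendsto _).comp hlim₁
  have hDl := (continuous_snd.tendsto _).comp hlim₁
  simp only [Function.comp_def] at hv hDl
  -- weak convergence of the difference quotients
  have hint : ∀ k, ∫ t in (0 : ℝ)..1, ‖L (forwardDiff (u k) ⌊(n k : ℝ) * t⌋₊)‖ ^ 2
      = discreteDirichlet N (u k) := by
    intro k
    have h1 := integral_comp_natFloor (fun i => ‖L (forwardDiff (u k) i)‖ ^ 2) (hn k) le_rfl
    rw [div_self (by have := hn k; positivity)] at h1
    rw [h1, smul_eq_mul, ← sum_sq_forwardDiff N (hn k)]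
    simp only [hL]
  obtain ⟨ψ₂, hψ₂, G, hG, hGt, hGa⟩ := exists_subseq_tendsto_primitive L
    (g := fun k t => forwardDiff (u (ψ₁ k)) ⌊(n (ψ₁ k) : ℝ) * t⌋₊)
    (fun k => memLp_two_comp_natFloor _ _) (A := A) (fun k => (hint _).trans_le (hD _))
  have hv2 := hv.comp hψ₂.tendsto_atTop
  have hD2 := hDl.comp hψ₂.tendsto_atTop
  simp only [Function.comp_def] at hv2 hD2
  have hn2 : Tendsto (fun k => n (ψ₁ (ψ₂ k))) atTop atTop :=
    hnt.comp (hψ₁.tendsto_atTop.comp hψ₂.tendsto_atTop)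
  refine ⟨ψ₁ ∘ ψ₂, hψ₁.comp hψ₂, fun t => v + ∫ s in (0 : ℝ)..t, G s,
    memH1_of_eq_primitive hG fun _ _ => rfl, fun t ht => ?_, D + τ * N v ^ 2, ?_, ?_⟩
  · have h1 : Tendsto (fun k => extend (u (ψ₁ (ψ₂ k))) t - (layer (u (ψ₁ (ψ₂ k))) 0
        + ∫ s in (0 : ℝ)..t, forwardDiff (u (ψ₁ (ψ₂ k))) ⌊(n (ψ₁ (ψ₂ k)) : ℝ) * s⌋₊))
        atTop (𝓝 0) := by
      have h2 : Tendsto (fun k => ‖(L.symm : E →L[ℝ] V)‖ * √(A / n (ψ₁ (ψ₂ k)))) atTop (𝓝 0) := by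
        have h3 : Tendsto (fun k => A / (n (ψ₁ (ψ₂ k)) : ℝ)) atTop (𝓝 0) :=
          (tendsto_natCast_atTop_atTop.comp hn2).const_div_atTop A
        simpa using ((Real.continuous_sqrt.tendsto _).comp h3).const_mul ‖(L.symm : E →L[ℝ] V)‖
      refine squeeze_zero_norm (fun k => ?_) h2
      set w := extend (u (ψ₁ (ψ₂ k))) t - (layer (u (ψ₁ (ψ₂ k))) 0
        + ∫ s in (0 : ℝ)..t, forwardDiff (u (ψ₁ (ψ₂ k))) ⌊(n (ψ₁ (ψ₂ k)) : ℝ) * s⌋₊) with hw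
      calc ‖w‖ = ‖(L.symm : E →L[ℝ] V) (L w)‖ := by simp
        _ ≤ ‖(L.symm : E →L[ℝ] V)‖ * ‖L w‖ := ContinuousLinearMap.le_opNorm _ _
        _ ≤ _ := by
          rw [hL]
          gcongr
          refine (seminorm_extend_sub_le N (hn _) _ ht).trans (Real.sqrt_le_sqrt ?_)
          gcongr
          exact hD _
    have h4 := h1.add (hv2.add (hGt t (Ico_subset_Icc_self ht)))
    simpa using h4
  · simp only [discreteReg_eq, Function.comp_def]
    exact hD2.add ((((hNc.tendsto v).comp hv2).pow 2).const_mul τ)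
  · rw [Problem.contReg_of_eq_primitive N τ hG fun _ _ => rfl]
    gcongr
    refine le_of_forall_pos_le_add fun ε hε => ?_
    have h1 := hGa (D + ε) (by
      refine Eventually.frequently ?_
      filter_upwards [hD2.eventually_lt_const (show D < D + ε by linarith)] with k hk
      rw [hint]
      exact hk.le)
    simpa only [hL] using h1

end DiscreteFunctions

/-! ### Sampling of functions in `H¹` -/

section Sampling

variable {V : Type*} [NormedAddCommGroup V]

/-- The values `f(0), f(1/n), …, f((n-1)/n)`. -/
def sample (f : ℝ → V) (n : ℕ) : Fin n → V := fun i => f ((i : ℝ) / n)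

theorem layer_sample (f : ℝ → V) {n i : ℕ} (hi : i < n) :
    layer (sample f n) i = f ((i : ℝ) / n) := by
  rw [layer, dif_pos hi]; rfl

theorem sq_integral_le {p : ℝ → ℝ} {a b : ℝ} (hab : a ≤ b) (hp : IntervalIntegrable p volume a b)
    (hp2 : IntervalIntegrable (fun t => p t ^ 2) volume a b) :
    (∫ t in a..b, p t) ^ 2 ≤ (b - a) * ∫ t in a..b, p t ^ 2 := by
  rcases hab.eq_or_lt with rfl | hlt
  · simp
  set I := ∫ t in a..b, p t with hI
  -- expand `0 ≤ ∫ ((b - a) p - ∫ p)²`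
  have h0 : 0 ≤ ∫ t in a..b, ((b - a) * p t - I) ^ 2 :=
    intervalIntegral.integral_nonneg hab fun _ _ => sq_nonneg _
  have h1 : ∫ t in a..b, ((b - a) * p t - I) ^ 2
      = (b - a) ^ 2 * (∫ t in a..b, p t ^ 2) - 2 * (b - a) * I * I + (b - a) * I ^ 2 := by
    have e : (fun t => ((b - a) * p t - I) ^ 2)
        = fun t => (b - a) ^ 2 * p t ^ 2 - 2 * (b - a) * I * p t + I ^ 2 := by
      funext t; ring
    rw [e, intervalIntegral.integral_add ((hp2.const_mul _).sub (hp.const_mul _))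
      intervalIntegrable_const, intervalIntegral.integral_sub (hp2.const_mul _) (hp.const_mul _),
      intervalIntegral.integral_const_mul, intervalIntegral.integral_const_mul,
      intervalIntegral.integral_const, smul_eq_mul]
  rw [h1] at h0
  have h2 : 0 ≤ (b - a) * ((b - a) * (∫ t in a..b, p t ^ 2) - I ^ 2) := by linarith
  linarith [nonneg_of_mul_nonneg_right h2 (sub_pos.2 hlt)]

/-- Sampling does not increase the regularisation (Cauchy–Schwarz on each subinterval). -/
theorem discreteReg_sample_le [NormedSpace ℝ V] [FiniteDimensional ℝ V] (N : Seminorm ℝ V)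
    (hN : ∀ v, N v = 0 → v = 0) (τ : ℝ) {f : ℝ → V} (hf : MemH1 f) {n : ℕ} (hn : 1 ≤ n) :
    Problem.discreteReg N τ (sample f n) ≤ Problem.contReg N τ f := by
  have hcomplete : CompleteSpace V := FiniteDimensional.complete ℝ V
  obtain ⟨E, _, _, L, hL⟩ := exists_continuousLinearEquiv_norm_eq N hN
  have hcompleteE : CompleteSpace E :=
    have := L.toLinearEquiv.finiteDimensional
    FiniteDimensional.complete ℝ E
  have hn0 : (0 : ℝ) < n := by exact_mod_cast hn
  have hg := hf.hasL2WeakDeriv.weakDeriv_spec.1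
  set g := weakDeriv f
  have hprim := hf.eq_primitive
  have hgL : MemLp (fun t => L (g t)) 2 (volume.restrict (Icc (0 : ℝ) 1)) :=
    (L : V →L[ℝ] E).comp_memLp' hg
  have hgi : ∀ a ∈ Icc (0 : ℝ) 1, ∀ b ∈ Icc (0 : ℝ) 1, IntervalIntegrable g volume a b :=
    fun a ha b hb => memLp_two_intervalIntegrable hg ha hb
  have hgLi : ∀ a ∈ Icc (0 : ℝ) 1, ∀ b ∈ Icc (0 : ℝ) 1,
      IntervalIntegrable (fun t => ‖L (g t)‖) volume a b :=
    fun a ha b hb => (memLp_two_intervalIntegrable hgL ha hb).norm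
  have hg2 : ∀ a ∈ Icc (0 : ℝ) 1, ∀ b ∈ Icc (0 : ℝ) 1,
      IntervalIntegrable (fun t => ‖L (g t)‖ ^ 2) volume a b := by
    intro a ha b hb
    have h2 : IntervalIntegrable (fun t => ‖L (g t)‖ ^ 2) volume 0 1 :=
      (intervalIntegrable_iff_integrableOn_Icc_of_le zero_le_one).2
        (hgL.integrable_norm_pow (by simp))
    refine h2.mono_set (uIcc_subset_uIcc ?_ ?_) <;> rwa [uIcc_of_le zero_le_one]
  have hmem : ∀ k : ℕ, k ≤ n → (k : ℝ) / n ∈ Icc (0 : ℝ) 1 := fun k hk =>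
    ⟨by positivity, (div_le_one hn0).2 (by exact_mod_cast hk)⟩
  have h0 : layer (sample f n) 0 = f 0 := by rw [layer_sample f (by omega)]; simp
  rw [discreteReg_eq, Problem.contReg, h0]
  gcongr
  rw [discreteDirichlet_eq_sum_range, Finset.mul_sum]
  calc ∑ i ∈ Finset.range (n - 1), (n : ℝ) *
        N (layer (sample f n) (i + 1) - layer (sample f n) i) ^ 2
      ≤ ∑ i ∈ Finset.range (n - 1), ∫ t in (i : ℝ) / n..((i + 1 : ℕ) : ℝ) / n, ‖L (g t)‖ ^ 2 := by
        refine Finset.sum_le_sum fun i hi => ?_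
        rw [Finset.mem_range] at hi
        have m1 := hmem i (by omega)
        have m2 := hmem (i + 1) (by omega)
        have hle : (i : ℝ) / n ≤ ((i + 1 : ℕ) : ℝ) / n := by push_cast; gcongr; linarith
        rw [layer_sample f (by omega), layer_sample f (by omega), hprim _ m1, hprim _ m2,
          add_sub_add_left_eq_sub, intervalIntegral.integral_interval_sub_left
            (hgi _ (by simp) _ m2) (hgi _ (by simp) _ m1), ← hL]
        have hn1 : ‖L (∫ t in (i : ℝ) / n..((i + 1 : ℕ) : ℝ) / n, g t)‖
            ≤ ∫ t in (i : ℝ) / n..((i + 1 : ℕ) : ℝ) / n, ‖L (g t)‖ := by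
          have : L (∫ t in (i : ℝ) / n..((i + 1 : ℕ) : ℝ) / n, g t)
              = ∫ t in (i : ℝ) / n..((i + 1 : ℕ) : ℝ) / n, L (g t) :=
            ((L : V →L[ℝ] E).intervalIntegral_comp_comm (hgi _ m1 _ m2)).symm
          rw [this]
          exact intervalIntegral.norm_integral_le_integral_norm hle
        calc (n : ℝ) * ‖L (∫ t in (i : ℝ) / n..((i + 1 : ℕ) : ℝ) / n, g t)‖ ^ 2
            ≤ n * (∫ t in (i : ℝ) / n..((i + 1 : ℕ) : ℝ) / n, ‖L (g t)‖) ^ 2 := by gcongr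
          _ ≤ n * ((((i + 1 : ℕ) : ℝ) / n - (i : ℝ) / n) *
              ∫ t in (i : ℝ) / n..((i + 1 : ℕ) : ℝ) / n, ‖L (g t)‖ ^ 2) := by
            gcongr
            exact sq_integral_le hle (hgLi _ m1 _ m2) (hg2 _ m1 _ m2)
          _ = ∫ t in (i : ℝ) / n..((i + 1 : ℕ) : ℝ) / n, ‖L (g t)‖ ^ 2 := by
            push_cast
            field_simp
            ring
    _ = ∫ t in (0 : ℝ)..((n - 1 : ℕ) : ℝ) / n, ‖L (g t)‖ ^ 2 := by
        have h := intervalIntegral.sum_integral_adjacent_intervals (μ := volume)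
          (f := fun t : ℝ => ‖L (g t)‖ ^ 2) (a := fun k : ℕ => (k : ℝ) / n) (n := n - 1)
          (fun k hk => hg2 _ (hmem k (by omega)) _ (hmem (k + 1) (by omega)))
        simp only [Nat.cast_zero, zero_div] at h
        exact h
    _ ≤ ∫ t in (0 : ℝ)..1, ‖L (g t)‖ ^ 2 := by
        refine intervalIntegral.integral_mono_interval le_rfl (hmem _ (by omega)).1
          (hmem _ (by omega)).2 (Eventually.of_forall fun _ => by positivity)
          (hg2 _ (by simp) _ (by simp))
    _ = _ := by simp only [hL, g]

theorem tendsto_natFloor_mul_div {t : ℝ} (ht : 0 ≤ t) :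
    Tendsto (fun n : ℕ => (⌊(n : ℝ) * t⌋₊ : ℝ) / n) atTop (𝓝 t) := by
  have := (tendsto_nat_floor_mul_div_atTop ht).comp (tendsto_natCast_atTop_atTop (R := ℝ))
  simpa [Function.comp_def, mul_comm] using this

theorem tendsto_extend_sample {f : ℝ → V} (hf : ContinuousOn f (Icc (0 : ℝ) 1)) {t : ℝ}
    (ht : t ∈ Ico (0 : ℝ) 1) : Tendsto (fun n => extend (sample f n) t) atTop (𝓝 (f t)) := by
  have h1 : Tendsto (fun n : ℕ => (⌊(n : ℝ) * t⌋₊ : ℝ) / n) atTop (𝓝[Icc 0 1] t) := by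
    refine tendsto_nhdsWithin_iff.2 ⟨tendsto_natFloor_mul_div ht.1, ?_⟩
    filter_upwards [eventually_ge_atTop 1] with n hn
    exact ⟨by positivity, (natFloor_mul_div_mem hn ht.1).1.trans ht.2.le⟩
  refine ((hf t (Ico_subset_Icc_self ht)).tendsto.comp h1).congr' ?_
  filter_upwards [eventually_ge_atTop 1] with n hn
  rw [extend, layer_sample f (natFloor_mul_lt hn ht.2), Function.comp_apply]

end Sampling

/-! ### Global solutions of differential equations -/

section GlobalExistence

/-- Coordinatewise truncation to the cube `[-R,R]^d`. -/
def clamp {d : ℕ} (R : ℝ) (x : Fin d → ℝ) : Fin d → ℝ := fun i => max (-R) (min R (x i))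

theorem clamp_eq_self {d : ℕ} {R : ℝ} {x : Fin d → ℝ} (hx : ‖x‖ ≤ R) : clamp R x = x := by
  funext i
  have := abs_le.1 ((Real.norm_eq_abs _).symm.trans_le ((norm_le_pi_norm x i).trans hx))
  rw [clamp, min_eq_right this.2, max_eq_right this.1]

theorem norm_clamp_le {d : ℕ} {R : ℝ} (hR : 0 ≤ R) (x : Fin d → ℝ) : ‖clamp R x‖ ≤ R := by
  refine (pi_norm_le_iff_of_nonneg hR).2 fun i => ?_
  rw [Real.norm_eq_abs, abs_le]
  exact ⟨le_max_left _ _, max_le (by linarith) (min_le_left _ _)⟩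

theorem norm_clamp_le_norm {d : ℕ} {R : ℝ} (hR : 0 ≤ R) (x : Fin d → ℝ) : ‖clamp R x‖ ≤ ‖x‖ := by
  refine (pi_norm_le_iff_of_nonneg (norm_nonneg _)).2 fun i => le_trans ?_ (norm_le_pi_norm x i)
  rw [Real.norm_eq_abs, Real.norm_eq_abs, abs_le]
  constructor
  · exact le_max_of_le_right (le_min (by linarith [abs_nonneg (x i)]) (neg_abs_le _))
  · exact max_le (by linarith [abs_nonneg (x i)]) ((min_le_right _ _).trans (le_abs_self _))

theorem lipschitzWith_clamp {d : ℕ} (R : ℝ) : LipschitzWith 1 (clamp (d := d) R) := by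
  refine LipschitzWith.of_dist_le_mul fun x y => ?_
  rw [NNReal.coe_one, one_mul]
  refine (dist_pi_le_iff dist_nonneg).2 fun i => le_trans ?_ (dist_le_pi_dist x y i)
  rw [Real.dist_eq, Real.dist_eq, clamp, clamp]
  refine (abs_max_sub_max_le_max _ _ _ _).trans (max_le (by simp) ?_)
  exact (abs_min_sub_min_le_max _ _ _ _).trans (max_le (by simp) le_rfl)

theorem hasDerivWithinAt_Ici_of_Icc {E : Type*} [NormedAddCommGroup E] [NormedSpace ℝ E]
    {X : ℝ → E} {v : E} {t : ℝ} (ht : t ∈ Ico (0 : ℝ) 1)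
    (h : HasDerivWithinAt X v (Icc (0 : ℝ) 1) t) : HasDerivWithinAt X v (Ici t) t :=
  h.mono_of_mem_nhdsWithin (mem_of_superset (Icc_mem_nhdsGE ht.2) (Icc_subset_Icc_left ht.1))

/-- Global existence for a field that is Lipschitz in space. The field is truncated in space, so
that the Picard–Lindelöf theorem applies on the whole of `[0,1]`; by Grönwall's inequality the
solution never leaves the region where the truncation is inactive. -/
theorem exists_hasDerivWithinAt_of_lipschitzWith {d : ℕ} {F : ℝ → (Fin d → ℝ) → Fin d → ℝ}
    {C : NNReal} (hF : ∀ t ∈ Icc (0 : ℝ) 1, LipschitzWith C (F t))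
    (hFc : ∀ x, ContinuousOn (fun t => F t x) (Icc (0 : ℝ) 1)) (x₀ : Fin d → ℝ) :
    ∃ X : ℝ → Fin d → ℝ, X 0 = x₀ ∧
      ∀ t ∈ Icc (0 : ℝ) 1, HasDerivWithinAt X (F t (X t)) (Icc (0 : ℝ) 1) t := by
  obtain ⟨B, hB⟩ := isCompact_Icc.exists_bound_of_continuousOn (hFc 0)
  have hB0 : 0 ≤ B := (norm_nonneg _).trans (hB 0 (by simp))
  have hgrow : ∀ t ∈ Icc (0 : ℝ) 1, ∀ x, ‖F t x‖ ≤ C * ‖x‖ + B := by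
    intro t ht x
    have h1 := (hF t ht).norm_sub_le x 0
    rw [sub_zero] at h1
    calc ‖F t x‖ = ‖(F t x - F t 0) + F t 0‖ := by rw [sub_add_cancel]
      _ ≤ ‖F t x - F t 0‖ + ‖F t 0‖ := norm_add_le _ _
      _ ≤ _ := add_le_add h1 (hB t ht)
  -- bounds the solutions of all truncated equations
  set R := gronwallBound ‖x₀‖ C B 1 with hR
  have hmono := gronwallBound_mono (norm_nonneg x₀) hB0 C.2
  have hR0 : 0 ≤ R := by
    have := hmono zero_le_one
    rw [gronwallBound_x0] at this
    exact (norm_nonneg x₀).trans this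
  let M : NNReal := ⟨C * R + B, by positivity⟩
  have hPL : IsPicardLindelof (fun t x => F t (clamp R x)) (tmin := 0) (tmax := 1)
      ⟨0, by simp⟩ x₀ M 0 M C :=
    { lipschitzOnWith := fun t ht => by
        have := (hF t ht).comp (lipschitzWith_clamp (d := d) R)
        rw [mul_one] at this
        exact this.lipschitzOnWith
      continuousOn := fun x _ => hFc _
      norm_le := fun t ht x _ => (hgrow t ht _).trans (by
        change _ ≤ (C : ℝ) * R + B
        gcongr
        exact norm_clamp_le hR0 x)
      mul_max_le := by simp }
  obtain ⟨X, hX0, hX⟩ := hPL.exists_eq_forall_mem_Icc_hasDerivWithinAt₀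
  have hXR : ∀ t ∈ Icc (0 : ℝ) 1, ‖X t‖ ≤ R := by
    intro t ht
    have h1 := norm_le_gronwallBound_of_norm_deriv_right_le (a := 0) (b := 1)
      (fun t ht => (hX t ht).continuousWithinAt)
      (fun t ht => hasDerivWithinAt_Ici_of_Icc ht (hX t (Ico_subset_Icc_self ht)))
      (show ‖X 0‖ ≤ ‖x₀‖ by rw [hX0]) (fun t ht =>
        (hgrow t (Ico_subset_Icc_self ht) (clamp R (X t))).trans (by
          gcongr; exact norm_clamp_le_norm hR0 _)) t ht
    rw [sub_zero] at h1
    exact h1.trans (hmono ht.2)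
  refine ⟨X, hX0, fun t ht => ?_⟩
  have := hX t ht
  rwa [clamp_eq_self (hXR t ht)] at this

end GlobalExistence

/-! ### The network as an Euler scheme -/

section Flow

-- the norms with respect to which membership in `H¹` is stated in `ContParam`
attribute [local instance] Matrix.normedAddCommGroup Matrix.normedSpace

theorem norm_mulVec_le {m d : ℕ} (A : Matrix (Fin m) (Fin d) ℝ) (x : Fin d → ℝ) :
    ‖A.mulVec x‖ ≤ d * ‖A‖ * ‖x‖ := by
  refine (pi_norm_le_iff_of_nonneg (by positivity)).2 fun i => ?_
  rw [Matrix.mulVec, dotProduct]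
  refine (norm_sum_le _ _).trans ?_
  calc ∑ j, ‖A i j * x j‖ ≤ ∑ _j : Fin d, ‖A‖ * ‖x‖ := by
        refine Finset.sum_le_sum fun j _ => ?_
        rw [norm_mul]
        exact mul_le_mul (Matrix.norm_entry_le_entrywise_sup_norm A) (norm_le_pi_norm x j)
          (norm_nonneg _) (norm_nonneg _)
    _ = d * ‖A‖ * ‖x‖ := by simp [mul_assoc]

theorem tendsto_mulVec {m d : ℕ} {A : ℕ → Matrix (Fin m) (Fin d) ℝ} {x : ℕ → Fin d → ℝ}
    {A₀ : Matrix (Fin m) (Fin d) ℝ} {x₀ : Fin d → ℝ} (hA : Tendsto A atTop (𝓝 A₀))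
    (hx : Tendsto x atTop (𝓝 x₀)) :
    Tendsto (fun k => (A k).mulVec (x k)) atTop (𝓝 (A₀.mulVec x₀)) := by
  have hc : Continuous fun p : Matrix (Fin m) (Fin d) ℝ × (Fin d → ℝ) => p.1.mulVec p.2 :=
    continuous_fst.matrix_mulVec continuous_snd
  exact Tendsto.comp (hc.tendsto (A₀, x₀)) (hA.prodMk_nhds hx)

theorem continuousOn_mulVec {m d : ℕ} {A : ℝ → Matrix (Fin m) (Fin d) ℝ} {x : ℝ → Fin d → ℝ}
    {s : Set ℝ} (hA : ContinuousOn A s) (hx : ContinuousOn x s) :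
    ContinuousOn (fun t => (A t).mulVec (x t)) s := by
  have hc : Continuous fun p : Matrix (Fin m) (Fin d) ℝ × (Fin d → ℝ) => p.1.mulVec p.2 :=
    continuous_fst.matrix_mulVec continuous_snd
  exact hc.comp_continuousOn (hA.prodMk hx)

theorem exists_bound_of_continuousOn_Icc {V : Type*} [NormedAddCommGroup V] {f : ℝ → V}
    (hf : ContinuousOn f (Icc (0 : ℝ) 1)) : ∃ R : NNReal, ∀ t ∈ Icc (0 : ℝ) 1, ‖f t‖ ≤ R := by
  obtain ⟨R, hR⟩ := isCompact_Icc.exists_bound_of_continuousOn hf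
  exact ⟨⟨R, (norm_nonneg _).trans (hR 0 (by simp))⟩, hR⟩

namespace Problem

variable {d m S : ℕ} (P : Problem d m S)

theorem lipschitzWith_field {L : NNReal} (hσ : LipschitzWith L P.σ)
    {K : Matrix (Fin d) (Fin d) ℝ} {R : NNReal} (hK : ‖K‖ ≤ R) (b : Fin d → ℝ) :
    LipschitzWith (L * (d * R)) fun x => P.σ (K.mulVec x + b) := by
  refine hσ.comp (LipschitzWith.of_dist_le_mul fun x y => ?_)
  rw [dist_eq_norm, dist_eq_norm, add_sub_add_right_eq_sub, ← Matrix.mulVec_sub]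
  refine (norm_mulVec_le _ _).trans ?_
  push_cast
  gcongr

variable {P} {K : ℝ → Matrix (Fin d) (Fin d) ℝ} {b : ℝ → Fin d → ℝ}

theorem exists_isSolution {L : NNReal} (hσ : LipschitzWith L P.σ)
    (hK : ContinuousOn K (Icc (0 : ℝ) 1)) (hb : ContinuousOn b (Icc (0 : ℝ) 1))
    (x₀ : Fin d → ℝ) : ∃ X, P.IsSolution K b x₀ X := by
  obtain ⟨R, hR⟩ := exists_bound_of_continuousOn_Icc hK
  exact exists_hasDerivWithinAt_of_lipschitzWith
    (F := fun t x => P.σ ((K t).mulVec x + b t))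
    (fun t ht => P.lipschitzWith_field hσ (hR t ht) (b t))
    (fun x => hσ.continuous.comp_continuousOn
      ((continuousOn_mulVec hK continuousOn_const).add hb)) x₀

theorem IsSolution.eqOn {L : NNReal} (hσ : LipschitzWith L P.σ)
    (hK : ContinuousOn K (Icc (0 : ℝ) 1)) {x₀ : Fin d → ℝ} {X Y : ℝ → Fin d → ℝ}
    (hX : P.IsSolution K b x₀ X) (hY : P.IsSolution K b x₀ Y) : EqOn X Y (Icc 0 1) := by
  obtain ⟨R, hR⟩ := exists_bound_of_continuousOn_Icc hK
  exact ODE_solution_unique_of_mem_Icc_right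
    (v := fun t x => P.σ ((K t).mulVec x + b t)) (s := fun _ => univ)
    (fun t ht => (P.lipschitzWith_field hσ (hR t (Ico_subset_Icc_self ht)) (b t)).lipschitzOnWith)
    (fun t ht => (hX.2 t ht).continuousWithinAt)
    (fun t ht => hasDerivWithinAt_Ici_of_Icc ht (hX.2 t (Ico_subset_Icc_self ht)))
    (fun _ _ => mem_univ _)
    (fun t ht => (hY.2 t ht).continuousWithinAt)
    (fun t ht => hasDerivWithinAt_Ici_of_Icc ht (hY.2 t (Ico_subset_Icc_self ht)))
    (fun _ _ => mem_univ _) (hX.1.trans hY.1.symm)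

theorem isSolution_solution {L : NNReal} (hσ : LipschitzWith L P.σ)
    (hK : ContinuousOn K (Icc (0 : ℝ) 1)) (hb : ContinuousOn b (Icc (0 : ℝ) 1))
    (x₀ : Fin d → ℝ) : P.IsSolution K b x₀ (P.solution K b x₀) := by
  have h := exists_isSolution hσ hK hb x₀
  rw [solution, dif_pos h]
  exact h.choose_spec

theorem IsSolution.continuousOn {x₀ : Fin d → ℝ} {X : ℝ → Fin d → ℝ}
    (hX : P.IsSolution K b x₀ X) : ContinuousOn X (Icc 0 1) :=
  fun t ht => (hX.2 t ht).continuousWithinAt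

theorem IsSolution.integral_eq_sub {L : NNReal} (hσ : LipschitzWith L P.σ)
    (hK : ContinuousOn K (Icc (0 : ℝ) 1)) (hb : ContinuousOn b (Icc (0 : ℝ) 1))
    {x₀ : Fin d → ℝ} {X : ℝ → Fin d → ℝ} (hX : P.IsSolution K b x₀ X) {s t : ℝ}
    (hs : 0 ≤ s) (hst : s ≤ t) (ht : t ≤ 1) :
    ∫ r in s..t, P.σ ((K r).mulVec (X r) + b r) = X t - X s := by
  have hsub : Icc s t ⊆ Icc 0 1 := Icc_subset_Icc hs ht
  refine intervalIntegral.integral_eq_sub_of_hasDerivAt_of_le hst (hX.continuousOn.mono hsub)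
    (fun r hr => ?_) ?_
  · exact (hX.2 r (hsub (Ioo_subset_Icc_self hr))).hasDerivAt
      (Icc_mem_nhds (hs.trans_lt hr.1) (hr.2.trans_le ht))
  · refine ContinuousOn.intervalIntegrable ?_
    rw [uIcc_of_le hst]
    exact (hσ.continuous.comp_continuousOn
      ((continuousOn_mulVec hK hX.continuousOn).add hb)).mono hsub

/-- The local error of the Euler scheme: the distance between the argument of `σ` in the network,
evaluated along the exact trajectory at the grid point below `t`, and that in the differential
equation at `t`. -/
def localError {n : ℕ} (K : ℝ → Matrix (Fin d) (Fin d) ℝ) (b : ℝ → Fin d → ℝ)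
    (Kn : Fin n → Matrix (Fin d) (Fin d) ℝ) (bn : Fin n → Fin d → ℝ) (X : ℝ → Fin d → ℝ)
    (t : ℝ) : ℝ :=
  ‖(extend Kn t).mulVec (X (⌊(n : ℝ) * t⌋₊ / n)) + extend bn t - ((K t).mulVec (X t) + b t)‖

theorem localError_nonneg {n : ℕ} (Kn : Fin n → Matrix (Fin d) (Fin d) ℝ)
    (bn : Fin n → Fin d → ℝ) (X : ℝ → Fin d → ℝ) (t : ℝ) : 0 ≤ localError K b Kn bn X t :=
  norm_nonneg _

theorem aestronglyMeasurable_localError {n : ℕ} (hK : ContinuousOn K (Icc (0 : ℝ) 1))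
    (hb : ContinuousOn b (Icc (0 : ℝ) 1)) {X : ℝ → Fin d → ℝ}
    (hX : ContinuousOn X (Icc (0 : ℝ) 1)) (Kn : Fin n → Matrix (Fin d) (Fin d) ℝ)
    (bn : Fin n → Fin d → ℝ) :
    AEStronglyMeasurable (localError K b Kn bn X) (volume.restrict (Icc (0 : ℝ) 1)) := by
  refine AEStronglyMeasurable.norm (AEStronglyMeasurable.sub ?_ ?_)
  · exact (stronglyMeasurable_comp_natFloor
      (fun i => (layer Kn i).mulVec (X (i / n)) + layer bn i) n).aestronglyMeasurable
  · exact ((continuousOn_mulVec hK hX).add hb).aestronglyMeasurable measurableSet_Icc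

theorem localError_le {n : ℕ} (hn : 1 ≤ n) {Kn : Fin n → Matrix (Fin d) (Fin d) ℝ}
    {bn : Fin n → Fin d → ℝ} {X : ℝ → Fin d → ℝ} {R M : ℝ} (hR : 0 ≤ R)
    (hKn : ∀ i, ‖layer Kn i‖ ≤ R) (hbn : ∀ i, ‖layer bn i‖ ≤ R)
    (hX : ∀ t ∈ Icc (0 : ℝ) 1, ‖X t‖ ≤ M)
    (hq : ∀ t ∈ Icc (0 : ℝ) 1, ‖(K t).mulVec (X t) + b t‖ ≤ M) {t : ℝ} (ht : t ∈ Icc (0 : ℝ) 1) :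
    localError K b Kn bn X t ≤ d * R * M + R + M := by
  have hfl : (⌊(n : ℝ) * t⌋₊ : ℝ) / n ∈ Icc (0 : ℝ) 1 :=
    ⟨by positivity, (natFloor_mul_div_mem hn ht.1).1.trans ht.2⟩
  refine (norm_sub_le _ _).trans (add_le_add ((norm_add_le _ _).trans
    (add_le_add ((norm_mulVec_le _ _).trans ?_) (hbn _))) (hq t ht))
  exact mul_le_mul (mul_le_mul_of_nonneg_left (hKn _) (Nat.cast_nonneg _)) (hX _ hfl)
    (norm_nonneg _) (by positivity)

theorem intervalIntegrable_localError {n : ℕ} (hn : 1 ≤ n) (hK : ContinuousOn K (Icc (0 : ℝ) 1))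
    (hb : ContinuousOn b (Icc (0 : ℝ) 1)) {X : ℝ → Fin d → ℝ}
    (hX : ContinuousOn X (Icc (0 : ℝ) 1)) {Kn : Fin n → Matrix (Fin d) (Fin d) ℝ}
    {bn : Fin n → Fin d → ℝ} {R : ℝ} (hR : 0 ≤ R) (hKn : ∀ i, ‖layer Kn i‖ ≤ R)
    (hbn : ∀ i, ‖layer bn i‖ ≤ R) {s t : ℝ} (hs : s ∈ Icc (0 : ℝ) 1) (ht : t ∈ Icc (0 : ℝ) 1) :
    IntervalIntegrable (localError K b Kn bn X) volume s t := by
  obtain ⟨M₁, hM₁⟩ := exists_bound_of_continuousOn_Icc hX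
  obtain ⟨M₂, hM₂⟩ := exists_bound_of_continuousOn_Icc ((continuousOn_mulVec hK hX).add hb)
  refine memLp_two_intervalIntegrable (MemLp.of_bound
    (aestronglyMeasurable_localError hK hb hX Kn bn) (d * R * max M₁ M₂ + R + max M₁ M₂) ?_) hs ht
  filter_upwards [ae_restrict_mem measurableSet_Icc] with r hr
  rw [Real.norm_of_nonneg (localError_nonneg _ _ _ _)]
  exact localError_le hn hR hKn hbn (fun t ht => (hM₁ t ht).trans (le_max_left _ _))
    (fun t ht => (hM₂ t ht).trans (le_max_right _ _)) hr

/-- Discrete Grönwall estimate for the distance between the states of the network and the exact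
trajectory: in each step the error grows at most by the factor `1 + a / n ≤ exp (a / n)`, where `a`
is a Lipschitz constant of the field, and by the integral of the local error over the step. -/
theorem norm_state_sub_le {L : NNReal} (hσ : LipschitzWith L P.σ) {n : ℕ} (hn : 1 ≤ n)
    (hK : ContinuousOn K (Icc (0 : ℝ) 1)) (hb : ContinuousOn b (Icc (0 : ℝ) 1))
    {x₀ : Fin d → ℝ} {X : ℝ → Fin d → ℝ} (hX : P.IsSolution K b x₀ X)
    {Kn : Fin n → Matrix (Fin d) (Fin d) ℝ} {bn : Fin n → Fin d → ℝ} {R : ℝ} (hR : 0 ≤ R)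
    (hKn : ∀ i, ‖layer Kn i‖ ≤ R) (hbn : ∀ i, ‖layer bn i‖ ≤ R) :
    ∀ i ≤ n, ‖P.state Kn bn x₀ i - X (i / n)‖
      ≤ Real.exp (L * (d * R) * (i / n)) * ∫ t in (0 : ℝ)..i / n, L * localError K b Kn bn X t := by
  have hn0 : (0 : ℝ) < n := by exact_mod_cast hn
  have hmem : ∀ k : ℕ, k ≤ n → (k : ℝ) / n ∈ Icc (0 : ℝ) 1 := fun k hk =>
    ⟨by positivity, (div_le_one hn0).2 (by exact_mod_cast hk)⟩
  set ρ : ℝ → ℝ := fun t => L * localError K b Kn bn X t with hρ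
  have hρ0 : ∀ t, 0 ≤ ρ t := fun t => mul_nonneg L.2 (localError_nonneg _ _ _ _)
  have hρi : ∀ s ∈ Icc (0 : ℝ) 1, ∀ t ∈ Icc (0 : ℝ) 1, IntervalIntegrable ρ volume s t :=
    fun s hs t ht => (intervalIntegrable_localError hn hK hb hX.continuousOn hR hKn hbn hs
      ht).const_mul _
  intro i
  induction i with
  | zero => intro _; simp [state, hX.1]
  | succ i ih =>
    intro hi
    have ih := ih (by omega)
    have m1 := hmem i (by omega)
    have m2 := hmem (i + 1) hi
    have hle : (i : ℝ) / n ≤ ((i + 1 : ℕ) : ℝ) / n := by push_cast; gcongr; linarith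
    have hlen : ((i + 1 : ℕ) : ℝ) / n - (i : ℝ) / n = 1 / n := by push_cast; ring
    set e := P.state Kn bn x₀ i - X (i / n) with he
    set w := P.σ ((layer Kn i).mulVec (P.state Kn bn x₀ i) + layer bn i) with hw
    set a : ℝ := L * (d * R) with ha
    have ha0 : 0 ≤ a := by positivity
    have hqi : IntervalIntegrable (fun r => P.σ ((K r).mulVec (X r) + b r)) volume
        ((i : ℝ) / n) (((i + 1 : ℕ) : ℝ) / n) := by
      refine ContinuousOn.intervalIntegrable ?_
      rw [uIcc_of_le hle]
      exact (hσ.continuous.comp_continuousOn ((continuousOn_mulVec hK hX.continuousOn).add hb)).mono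
        (Icc_subset_Icc m1.1 m2.2)
    have hstep : P.state Kn bn x₀ (i + 1) - X ((i + 1 : ℕ) / n)
        = e + ∫ r in (i : ℝ) / n..((i + 1 : ℕ) : ℝ) / n,
            (w - P.σ ((K r).mulVec (X r) + b r)) := by
      rw [intervalIntegral.integral_sub intervalIntegrable_const hqi,
        hX.integral_eq_sub hσ hK hb m1.1 hle m2.2, intervalIntegral.integral_const, hlen, he, state]
      abel
    have hpt : ∀ᵐ r, r ∈ Ioc ((i : ℝ) / n) (((i + 1 : ℕ) : ℝ) / n) →
        ‖w - P.σ ((K r).mulVec (X r) + b r)‖ ≤ a * ‖e‖ + ρ r := by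
      filter_upwards [measure_eq_zero_iff_ae_notMem.1 (measure_singleton
        (((i + 1 : ℕ) : ℝ) / n) : volume {((i + 1 : ℕ) : ℝ) / n} = 0)] with r hr1 hr
      have hfl : ⌊(n : ℝ) * r⌋₊ = i := natFloor_mul_eq hn hr.1.le (by
        have := lt_of_le_of_ne hr.2 hr1
        push_cast at this
        exact this)
      have h1 := hσ.norm_sub_le ((layer Kn i).mulVec (P.state Kn bn x₀ i) + layer bn i)
        ((K r).mulVec (X r) + b r)
      refine h1.trans ?_
      have h2 : (layer Kn i).mulVec (P.state Kn bn x₀ i) + layer bn i - ((K r).mulVec (X r) + b r)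
          = (layer Kn i).mulVec e
            + ((layer Kn i).mulVec (X (i / n)) + layer bn i - ((K r).mulVec (X r) + b r)) := by
        rw [he, Matrix.mulVec_sub]; abel
      have h3 : ‖(layer Kn i).mulVec e‖ ≤ d * R * ‖e‖ :=
        (norm_mulVec_le _ _).trans (by gcongr; exact hKn i)
      have h4 : ρ r = L * ‖(layer Kn i).mulVec (X (i / n)) + layer bn i
          - ((K r).mulVec (X r) + b r)‖ := by
        simp only [hρ, localError, extend, hfl]
      rw [h2, h4, ha, mul_assoc (L : ℝ), ← mul_add]
      gcongr
      exact (norm_add_le _ _).trans (add_le_add h3 le_rfl)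
    have hint : ‖∫ r in (i : ℝ) / n..((i + 1 : ℕ) : ℝ) / n, (w - P.σ ((K r).mulVec (X r) + b r))‖
        ≤ a * (1 / n) * ‖e‖ + ∫ r in (i : ℝ) / n..((i + 1 : ℕ) : ℝ) / n, ρ r := by
      refine (intervalIntegral.norm_integral_le_of_norm_le hle hpt
        (intervalIntegrable_const.add (hρi _ m1 _ m2))).trans_eq ?_
      rw [intervalIntegral.integral_add intervalIntegrable_const (hρi _ m1 _ m2),
        intervalIntegral.integral_const, hlen, smul_eq_mul]
      ring
    have hJ0 : 0 ≤ ∫ r in (i : ℝ) / n..((i + 1 : ℕ) : ℝ) / n, ρ r :=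
      intervalIntegral.integral_nonneg hle fun r _ => hρ0 r
    have hI0 : 0 ≤ ∫ r in (0 : ℝ)..(i : ℝ) / n, ρ r :=
      intervalIntegral.integral_nonneg m1.1 fun r _ => hρ0 r
    rw [hstep, ← intervalIntegral.integral_add_adjacent_intervals (hρi 0 (by simp) _ m1)
      (hρi _ m1 _ m2), mul_add]
    have hexp1 : 1 ≤ Real.exp (a * (((i + 1 : ℕ) : ℝ) / n)) :=
      Real.one_le_exp (mul_nonneg ha0 m2.1)
    have hexp2 : (1 + a * (1 / n)) * Real.exp (a * (i / n))
        ≤ Real.exp (a * (((i + 1 : ℕ) : ℝ) / n)) := by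
      have : a * (((i + 1 : ℕ) : ℝ) / n) = a * (1 / n) + a * (i / n) := by rw [← hlen]; ring
      rw [this, Real.exp_add]
      gcongr
      linarith [Real.add_one_le_exp (a * (1 / (n : ℝ)))]
    calc ‖e + ∫ r in (i : ℝ) / n..((i + 1 : ℕ) : ℝ) / n, (w - P.σ ((K r).mulVec (X r) + b r))‖
        ≤ ‖e‖ + (a * (1 / n) * ‖e‖ + ∫ r in (i : ℝ) / n..((i + 1 : ℕ) : ℝ) / n, ρ r) :=
          (norm_add_le _ _).trans (add_le_add le_rfl hint)
      _ = (1 + a * (1 / n)) * ‖e‖ + 1 * ∫ r in (i : ℝ) / n..((i + 1 : ℕ) : ℝ) / n, ρ r := by ring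
      _ ≤ (1 + a * (1 / n)) * (Real.exp (a * (i / n)) * ∫ r in (0 : ℝ)..(i : ℝ) / n, ρ r)
          + Real.exp (a * (((i + 1 : ℕ) : ℝ) / n))
            * ∫ r in (i : ℝ) / n..((i + 1 : ℕ) : ℝ) / n, ρ r := by gcongr
      _ ≤ _ := by rw [← mul_assoc]; gcongr

theorem norm_output_sub_le {L : NNReal} (hσ : LipschitzWith L P.σ) {n : ℕ} (hn : 1 ≤ n)
    (hK : ContinuousOn K (Icc (0 : ℝ) 1)) (hb : ContinuousOn b (Icc (0 : ℝ) 1))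
    {x₀ : Fin d → ℝ} {X : ℝ → Fin d → ℝ} (hX : P.IsSolution K b x₀ X)
    {Kn : Fin n → Matrix (Fin d) (Fin d) ℝ} {bn : Fin n → Fin d → ℝ} {R : ℝ} (hR : 0 ≤ R)
    (hKn : ∀ i, ‖layer Kn i‖ ≤ R) (hbn : ∀ i, ‖layer bn i‖ ≤ R) :
    ‖P.state Kn bn x₀ n - X 1‖
      ≤ Real.exp (L * (d * R)) * L * ∫ t in (0 : ℝ)..1, localError K b Kn bn X t := by
  have h := norm_state_sub_le hσ hn hK hb hX hR hKn hbn n le_rfl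
  have hn1 : (n : ℝ) / n = 1 := div_self (by positivity)
  rwa [hn1, mul_one, intervalIntegral.integral_const_mul, ← mul_assoc] at h

/-- The outputs of the networks converge to the time-one value of the limiting flow. -/
theorem tendsto_state {L : NNReal} (hσ : LipschitzWith L P.σ)
    (hK : ContinuousOn K (Icc (0 : ℝ) 1)) (hb : ContinuousOn b (Icc (0 : ℝ) 1))
    (x₀ : Fin d → ℝ) {n : ℕ → ℕ} (hn : ∀ k, 1 ≤ n k) (hnt : Tendsto n atTop atTop)
    {Kn : ∀ k, Fin (n k) → Matrix (Fin d) (Fin d) ℝ} {bn : ∀ k, Fin (n k) → Fin d → ℝ} {R : ℝ}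
    (hR : 0 ≤ R) (hKn : ∀ k i, ‖layer (Kn k) i‖ ≤ R) (hbn : ∀ k i, ‖layer (bn k) i‖ ≤ R)
    (hKt : ∀ t ∈ Ico (0 : ℝ) 1, Tendsto (fun k => extend (Kn k) t) atTop (𝓝 (K t)))
    (hbt : ∀ t ∈ Ico (0 : ℝ) 1, Tendsto (fun k => extend (bn k) t) atTop (𝓝 (b t))) :
    Tendsto (fun k => P.state (Kn k) (bn k) x₀ (n k)) atTop (𝓝 (P.solution K b x₀ 1)) := by
  set X := P.solution K b x₀ with hXdef
  have hX : P.IsSolution K b x₀ X := isSolution_solution hσ hK hb x₀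
  have hXc := hX.continuousOn
  obtain ⟨M₁, hM₁⟩ := exists_bound_of_continuousOn_Icc hXc
  obtain ⟨M₂, hM₂⟩ := exists_bound_of_continuousOn_Icc ((continuousOn_mulVec hK hXc).add hb)
  have hlim : Tendsto (fun k => ∫ t in (0 : ℝ)..1, localError K b (Kn k) (bn k) X t) atTop
      (𝓝 (∫ _t in (0 : ℝ)..1, (0 : ℝ))) := by
    refine intervalIntegral.tendsto_integral_filter_of_dominated_convergence
      (fun _ => d * R * max M₁ M₂ + R + max M₁ M₂) (Eventually.of_forall fun k => ?_)
      (Eventually.of_forall fun k => Eventually.of_forall fun t ht => ?_)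
      intervalIntegrable_const ?_
    · rw [uIoc_of_le zero_le_one]
      exact (aestronglyMeasurable_localError hK hb hXc _ _).mono_measure
        (Measure.restrict_mono Ioc_subset_Icc_self le_rfl)
    · rw [uIoc_of_le zero_le_one] at ht
      rw [Real.norm_of_nonneg (localError_nonneg _ _ _ _)]
      exact localError_le (hn k) hR (hKn k) (hbn k)
        (fun t ht => (hM₁ t ht).trans (le_max_left _ _))
        (fun t ht => (hM₂ t ht).trans (le_max_right _ _)) (Ioc_subset_Icc_self ht)
    · -- the piecewise constant extension has the value `0` at `t = 1`
      filter_upwards [measure_eq_zero_iff_ae_notMem.1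
        (measure_singleton (1 : ℝ) : volume {(1 : ℝ)} = 0)] with t ht1 ht
      rw [uIoc_of_le zero_le_one] at ht
      have ht' : t ∈ Ico (0 : ℝ) 1 := ⟨ht.1.le, lt_of_le_of_ne ht.2 ht1⟩
      have hXt : Tendsto (fun k => X (⌊(n k : ℝ) * t⌋₊ / n k)) atTop (𝓝 (X t)) := by
        refine (hXc t (Ico_subset_Icc_self ht')).tendsto.comp (tendsto_nhdsWithin_iff.2
          ⟨(tendsto_natFloor_mul_div ht'.1).comp hnt, Eventually.of_forall fun k => ?_⟩)
        exact ⟨by positivity, (natFloor_mul_div_mem (hn k) ht'.1).1.trans ht'.2.le⟩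
      have hmul := tendsto_mulVec (hKt t ht') hXt
      have hdiff := tendsto_iff_norm_sub_tendsto_zero.1 (hmul.add (hbt t ht'))
      exact hdiff
  rw [intervalIntegral.integral_zero] at hlim
  rw [tendsto_iff_norm_sub_tendsto_zero]
  have hlim2 := hlim.const_mul (Real.exp (L * (d * R)) * L)
  rw [mul_zero] at hlim2
  exact squeeze_zero (fun _ => norm_nonneg _)
    (fun k => norm_output_sub_le hσ (hn k) hK hb hX hR (hKn k) (hbn k)) hlim2

end Problem

end Flow

/-! ### Convergence in `L²` of piecewise constant extensions -/

section DistL2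

variable {V : Type*} [NormedAddCommGroup V] [NormedSpace ℝ V] [FiniteDimensional ℝ V]

theorem norm_extend_sub_le {V : Type*} [NormedAddCommGroup V] {n : ℕ} {u : Fin n → V}
    {f : ℝ → V} {R M : ℝ} (hu : ∀ i, ‖layer u i‖ ≤ R) (hf : ∀ t ∈ Icc (0 : ℝ) 1, ‖f t‖ ≤ M) {t : ℝ}
    (ht : t ∈ Icc (0 : ℝ) 1) : ‖extend u t - f t‖ ≤ R + M :=
  (norm_sub_le _ _).trans (add_le_add (hu _) (hf t ht))

theorem aestronglyMeasurable_extend_sub {n : ℕ} (u : Fin n → V) {f : ℝ → V}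
    (hf : ContinuousOn f (Icc (0 : ℝ) 1)) :
    AEStronglyMeasurable (fun t => extend u t - f t) (volume.restrict (Icc (0 : ℝ) 1)) :=
  (stronglyMeasurable_comp_natFloor (layer u) n).aestronglyMeasurable.sub
    (hf.aestronglyMeasurable measurableSet_Icc)

theorem tendsto_distL2_extend (N : Seminorm ℝ V) (hN : ∀ v, N v = 0 → v = 0) {n : ℕ → ℕ}
    {u : ∀ k, Fin (n k) → V} {f : ℝ → V} (hf : ContinuousOn f (Icc (0 : ℝ) 1)) {R : ℝ}
    (hu : ∀ k i, ‖layer (u k) i‖ ≤ R)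
    (hlim : ∀ t ∈ Ico (0 : ℝ) 1, Tendsto (fun k => extend (u k) t) atTop (𝓝 (f t))) :
    Tendsto (fun k => Problem.distL2 N (extend (u k)) f) atTop (𝓝 0) := by
  obtain ⟨M, hM⟩ := exists_bound_of_continuousOn_Icc hf
  obtain ⟨C, hC0, hC⟩ := exists_le_mul_norm N hN
  have hNc := continuous_of_definite N hN
  have h : Tendsto (fun k => ∫ t in (0 : ℝ)..1, N (extend (u k) t - f t) ^ 2) atTop
      (𝓝 (∫ _t in (0 : ℝ)..1, (0 : ℝ))) := by
    refine intervalIntegral.tendsto_integral_filter_of_dominated_convergence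
      (fun _ => (C * (R + M)) ^ 2) (Eventually.of_forall fun k => ?_)
      (Eventually.of_forall fun k => Eventually.of_forall fun t ht => ?_)
      intervalIntegrable_const ?_
    · rw [uIoc_of_le zero_le_one]
      exact ((hNc.pow 2).comp_aestronglyMeasurable
        (aestronglyMeasurable_extend_sub (u k) hf)).mono_measure
        (Measure.restrict_mono Ioc_subset_Icc_self le_rfl)
    · rw [uIoc_of_le zero_le_one] at ht
      rw [Real.norm_of_nonneg (sq_nonneg _)]
      refine pow_le_pow_left₀ (apply_nonneg N _) ((hC _).trans ?_) 2
      exact mul_le_mul_of_nonneg_left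
        (norm_extend_sub_le (hu k) hM (Ioc_subset_Icc_self ht)) hC0
    · -- the piecewise constant extension has the value `0` at `t = 1`
      filter_upwards [measure_eq_zero_iff_ae_notMem.1
        (measure_singleton (1 : ℝ) : volume {(1 : ℝ)} = 0)] with t ht1 ht
      rw [uIoc_of_le zero_le_one] at ht
      have h1 := (hlim t ⟨ht.1.le, lt_of_le_of_ne ht.2 ht1⟩).sub_const (f t)
      rw [sub_self] at h1
      have h2 := ((hNc.pow 2).tendsto 0).comp h1
      simpa [Function.comp_def] using h2
  rw [intervalIntegral.integral_zero] at h
  have := (Real.continuous_sqrt.tendsto 0).comp h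
  rwa [Real.sqrt_zero] at this

/-- Limits in `L²` are unique among continuous functions. -/
theorem eqOn_of_tendsto_distL2 (N : Seminorm ℝ V) (hN : ∀ v, N v = 0 → v = 0) {n : ℕ → ℕ}
    {u : ∀ k, Fin (n k) → V} {f g : ℝ → V} (hf : ContinuousOn f (Icc (0 : ℝ) 1))
    (hg : ContinuousOn g (Icc (0 : ℝ) 1))
    (hlf : Tendsto (fun k => Problem.distL2 N (extend (u k)) f) atTop (𝓝 0))
    (hlg : Tendsto (fun k => Problem.distL2 N (extend (u k)) g) atTop (𝓝 0)) :
    EqOn f g (Icc 0 1) := by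
  have hNc := continuous_of_definite N hN
  obtain ⟨C, hC0, hC⟩ := exists_le_mul_norm N hN
  have hint : ∀ (w : ℝ → V), ContinuousOn w (Icc (0 : ℝ) 1) → ∀ k,
      IntervalIntegrable (fun t => N (extend (u k) t - w t) ^ 2) volume 0 1 := by
    intro w hw k
    obtain ⟨M, hM⟩ := exists_bound_of_continuousOn_Icc hw
    refine memLp_two_intervalIntegrable (MemLp.of_bound ((hNc.pow 2).comp_aestronglyMeasurable
      (aestronglyMeasurable_extend_sub (u k) hw))
      ((C * (∑ i ∈ Finset.range (n k + 1), ‖layer (u k) i‖ + M)) ^ 2) ?_) (by simp) (by simp)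
    filter_upwards [ae_restrict_mem measurableSet_Icc] with t ht
    change ‖N (extend (u k) t - w t) ^ 2‖ ≤ _
    rw [Real.norm_of_nonneg (sq_nonneg _)]
    refine pow_le_pow_left₀ (apply_nonneg N _) ((hC _).trans ?_) 2
    refine mul_le_mul_of_nonneg_left ((norm_sub_le _ _).trans (add_le_add ?_ (hM t ht))) hC0
    exact norm_comp_natFloor_le (layer (u k)) (n k) ht.2
  have hcont : ContinuousOn (fun t => N (f t - g t) ^ 2) (Icc 0 1) :=
    (hNc.pow 2).comp_continuousOn (hf.sub hg)
  have hle : ∀ k, ∫ t in (0 : ℝ)..1, N (f t - g t) ^ 2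
      ≤ 2 * Problem.distL2 N (extend (u k)) f ^ 2 + 2 * Problem.distL2 N (extend (u k)) g ^ 2 := by
    intro k
    rw [Problem.distL2, Problem.distL2, Real.sq_sqrt, Real.sq_sqrt,
      ← intervalIntegral.integral_const_mul, ← intervalIntegral.integral_const_mul,
      ← intervalIntegral.integral_add ((hint f hf k).const_mul 2) ((hint g hg k).const_mul 2)]
    · refine intervalIntegral.integral_mono_on zero_le_one
        (ContinuousOn.intervalIntegrable (by rwa [uIcc_of_le zero_le_one]))
        (((hint f hf k).const_mul 2).add ((hint g hg k).const_mul 2)) fun t _ => ?_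
      have h1 : N (f t - g t) ≤ N (extend (u k) t - f t) + N (extend (u k) t - g t) := by
        calc N (f t - g t) = N ((extend (u k) t - g t) - (extend (u k) t - f t)) := by
              congr 1; abel
          _ ≤ N (extend (u k) t - g t) + N (extend (u k) t - f t) := map_sub_le_add N _ _
          _ = _ := add_comm _ _
      have h0 := apply_nonneg N (f t - g t)
      nlinarith [sq_nonneg (N (extend (u k) t - f t) - N (extend (u k) t - g t))]
    all_goals exact intervalIntegral.integral_nonneg zero_le_one fun _ _ => sq_nonneg _
  have hzero : ∫ t in (0 : ℝ)..1, N (f t - g t) ^ 2 ≤ 0 := by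
    have h := ((hlf.pow 2).const_mul 2).add ((hlg.pow 2).const_mul 2)
    rw [zero_pow two_ne_zero, mul_zero, add_zero] at h
    exact ge_of_tendsto' h hle
  have hzero' : ∫ t in Icc (0 : ℝ) 1, N (f t - g t) ^ 2 = 0 := by
    rw [integral_Icc_eq_integral_Ioc, ← intervalIntegral.integral_of_le zero_le_one]
    exact le_antisymm hzero
      (intervalIntegral.integral_nonneg zero_le_one fun _ _ => sq_nonneg _)
  have hae := (integral_eq_zero_iff_of_nonneg (fun _ => sq_nonneg _)
    hcont.integrableOn_Icc).1 hzero'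
  refine Measure.eqOn_Icc_of_ae_eq volume zero_ne_one ?_ hf hg
  filter_upwards [hae] with t ht
  exact sub_eq_zero.1 (hN _ (pow_eq_zero_iff (two_ne_zero)|>.1 ht))

end DistL2

/-! ### Convergence of parameters and bounds by the energy -/

section Energies

attribute [local instance] Matrix.normedAddCommGroup Matrix.normedSpace

namespace Problem

variable {d m S : ℕ}

/-- The standing assumptions on the learning problem: genuine norms, positive weights, continuous
`h` and Lipschitz continuous `σ`. -/
structure Admissible (P : Problem d m S) : Prop where
  normd_def : ∀ v, P.normd v = 0 → v = 0
  normm_def : ∀ v, P.normm v = 0 → v = 0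
  normdd_def : ∀ A, P.normdd A = 0 → A = 0
  normmd_def : ∀ A, P.normmd A = 0 → A = 0
  α₁_pos : 0 < P.α₁
  α₂_pos : 0 < P.α₂
  α₃_pos : 0 < P.α₃
  α₄_pos : 0 < P.α₄
  τ₁_pos : 0 < P.τ₁
  τ₂_pos : 0 < P.τ₂
  continuous_h : Continuous P.h
  lipschitz_σ : ∃ L : NNReal, LipschitzWith L P.σ

/-- Pointwise convergence on `[0,1)` of the piecewise constant extensions of the layer parameters,
together with convergence of the parameters of the output layer. -/
structure PointwiseLimit {n : ℕ → ℕ} (θ : ∀ k, DiscreteParam d m (n k)) (θ₀ : ContParam d m) :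
    Prop where
  K : ∀ t ∈ Ico (0 : ℝ) 1, Tendsto (fun k => extend (θ k).K t) atTop (𝓝 (θ₀.K t))
  b : ∀ t ∈ Ico (0 : ℝ) 1, Tendsto (fun k => extend (θ k).b t) atTop (𝓝 (θ₀.b t))
  W : Tendsto (fun k => (θ k).W) atTop (𝓝 θ₀.W)
  c : Tendsto (fun k => (θ k).c) atTop (𝓝 θ₀.c)

/-- All parameters of the network are bounded by `R`. -/
structure BoundedBy {n : ℕ} (θ : DiscreteParam d m n) (R : ℝ) : Prop where
  K : ∀ i, ‖layer θ.K i‖ ≤ R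
  b : ∀ i, ‖layer θ.b i‖ ≤ R
  W : ‖θ.W‖ ≤ R
  c : ‖θ.c‖ ≤ R

variable {P : Problem d m S}

theorem discreteReg_nonneg {V : Type*} [NormedAddCommGroup V] [NormedSpace ℝ V]
    (N : Seminorm ℝ V) {τ : ℝ} (hτ : 0 < τ) {n : ℕ} (u : Fin n → V) : 0 ≤ discreteReg N τ u :=
  add_nonneg (discreteDirichlet_nonneg N u) (by positivity)

theorem sum_error_nonneg (P : Problem d m S) (W : Matrix (Fin m) (Fin d) ℝ) (c : Fin m → ℝ)
    (X : Fin S → Fin d → ℝ) : 0 ≤ ∑ s, P.error W c (X s) (P.y s) :=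
  Finset.sum_nonneg fun _ _ => sq_nonneg _

/-- Each regularising term is controlled by the energy. -/
theorem Admissible.terms_le (hP : P.Admissible) {n : ℕ} {θ : DiscreteParam d m n} {A : ℝ}
    (hA : P.energy n θ ≤ A) :
    discreteReg P.normdd P.τ₁ θ.K ≤ A / P.α₁ ∧ discreteReg P.normd P.τ₂ θ.b ≤ A / P.α₂ ∧
      P.normmd θ.W ^ 2 ≤ A / P.α₃ ∧ P.normm θ.c ^ 2 ≤ A / P.α₄ := by
  have h0 := sum_error_nonneg P θ.W θ.c fun s => P.state θ.K θ.b (P.x s) n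
  have h1 := mul_nonneg hP.α₁_pos.le (discreteReg_nonneg P.normdd hP.τ₁_pos θ.K)
  have h2 := mul_nonneg hP.α₂_pos.le (discreteReg_nonneg P.normd hP.τ₂_pos θ.b)
  have h3 := mul_nonneg hP.α₃_pos.le (sq_nonneg (P.normmd θ.W))
  have h4 := mul_nonneg hP.α₄_pos.le (sq_nonneg (P.normm θ.c))
  rw [energy] at hA
  rw [le_div_iff₀' hP.α₁_pos, le_div_iff₀' hP.α₂_pos, le_div_iff₀' hP.α₃_pos,
    le_div_iff₀' hP.α₄_pos]
  refine ⟨?_, ?_, ?_, ?_⟩ <;> linarith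

theorem Admissible.exists_boundedBy (hP : P.Admissible) (A : ℝ) :
    ∃ R : ℝ, 0 ≤ R ∧ ∀ (n : ℕ) (θ : DiscreteParam d m n), P.energy n θ ≤ A → BoundedBy θ R := by
  obtain ⟨R₁, h₁, H₁⟩ := exists_norm_layer_le P.normdd hP.normdd_def hP.τ₁_pos (A / P.α₁)
  obtain ⟨R₂, h₂, H₂⟩ := exists_norm_layer_le P.normd hP.normd_def hP.τ₂_pos (A / P.α₂)
  obtain ⟨R₃, h₃, H₃⟩ := exists_norm_le_of_sq_le P.normmd hP.normmd_def (A / P.α₃)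
  obtain ⟨R₄, h₄, H₄⟩ := exists_norm_le_of_sq_le P.normm hP.normm_def (A / P.α₄)
  refine ⟨R₁ + R₂ + R₃ + R₄, by positivity, fun n θ hA => ?_⟩
  obtain ⟨a₁, a₂, a₃, a₄⟩ := hP.terms_le hA
  exact ⟨fun i => (H₁ n _ a₁ i).trans (by linarith), fun i => (H₂ n _ a₂ i).trans (by linarith),
    (H₃ _ a₃).trans (by linarith), (H₄ _ a₄).trans (by linarith)⟩

theorem Admissible.continuous_error (hP : P.Admissible) {T : Type*} [TopologicalSpace T]
    {W : T → Matrix (Fin m) (Fin d) ℝ} {c : T → Fin m → ℝ} {X : T → Fin d → ℝ}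
    (hW : Continuous W) (hc : Continuous c) (hX : Continuous X) (y : Fin m → ℝ) :
    Continuous fun p => P.error (W p) (c p) (X p) y := by
  have h1 : Continuous fun p => (W p).mulVec (X p) + c p := (hW.matrix_mulVec hX).add hc
  have h2 : Continuous fun p => P.h ((W p).mulVec (X p) + c p) - y :=
    (hP.continuous_h.comp h1).sub continuous_const
  exact ((continuous_of_definite P.normm hP.normm_def).comp h2).pow 2

theorem Admissible.tendsto_error (hP : P.Admissible) {W : ℕ → Matrix (Fin m) (Fin d) ℝ}
    {c : ℕ → Fin m → ℝ} {X : ℕ → Fin d → ℝ} {W₀ : Matrix (Fin m) (Fin d) ℝ} {c₀ : Fin m → ℝ}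
    {X₀ : Fin d → ℝ} (hW : Tendsto W atTop (𝓝 W₀)) (hc : Tendsto c atTop (𝓝 c₀))
    (hX : Tendsto X atTop (𝓝 X₀)) (y : Fin m → ℝ) :
    Tendsto (fun k => P.error (W k) (c k) (X k) y) atTop (𝓝 (P.error W₀ c₀ X₀ y)) := by
  have h1 := (tendsto_mulVec hW hX).add hc
  have h2 := ((hP.continuous_h.tendsto _).comp h1).sub_const y
  exact (((continuous_of_definite P.normm hP.normm_def).tendsto _).comp h2).pow 2

/-! ### Minimisers of the discrete functionals -/

theorem continuous_layer {V : Type*} [NormedAddCommGroup V] {n : ℕ} (i : ℕ) :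
    Continuous fun u : Fin n → V => layer u i := by
  unfold layer
  split_ifs with h
  · exact continuous_apply _
  · exact continuous_const

theorem continuous_discreteReg {V : Type*} [NormedAddCommGroup V] [NormedSpace ℝ V]
    {N : Seminorm ℝ V} (hN : Continuous N) (τ : ℝ) {n : ℕ} :
    Continuous fun u : Fin n → V => discreteReg N τ u := by
  refine (continuous_const.mul (continuous_finsetSum _ fun i _ => ?_)).add
    (continuous_const.mul ((hN.comp (continuous_layer 0)).pow 2))
  exact (hN.comp ((continuous_layer i).sub (continuous_layer (i - 1)))).pow 2

theorem continuous_state (hσ : Continuous P.σ) (x₀ : Fin d → ℝ) {n : ℕ} {T : Type*}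
    [TopologicalSpace T] {K : T → Fin n → Matrix (Fin d) (Fin d) ℝ} {b : T → Fin n → Fin d → ℝ}
    (hK : Continuous K) (hb : Continuous b) (i : ℕ) :
    Continuous fun p => P.state (K p) (b p) x₀ i := by
  induction i with
  | zero => exact continuous_const
  | succ i ih =>
    have h1 : Continuous fun p => (layer (K p) i).mulVec (P.state (K p) (b p) x₀ i) :=
      ((continuous_layer i).comp hK).matrix_mulVec ih
    have h2 : Continuous fun p => layer (b p) i := (continuous_layer i).comp hb
    have h3 : Continuous fun p => P.σ ((layer (K p) i).mulVec (P.state (K p) (b p) x₀ i)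
        + layer (b p) i) := hσ.comp (h1.add h2)
    exact ih.add (h3.const_smul (1 / (n : ℝ)))

theorem Admissible.continuous_energy (hP : P.Admissible) {n : ℕ} {T : Type*} [TopologicalSpace T]
    {K : T → Fin n → Matrix (Fin d) (Fin d) ℝ} {b : T → Fin n → Fin d → ℝ}
    {W : T → Matrix (Fin m) (Fin d) ℝ} {c : T → Fin m → ℝ} (hK : Continuous K)
    (hb : Continuous b) (hW : Continuous W) (hc : Continuous c) :
    Continuous fun p => P.energy n ⟨K p, b p, W p, c p⟩ := by
  obtain ⟨L, hL⟩ := hP.lipschitz_σ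
  have h0 : Continuous fun p => ∑ s, P.error (W p) (c p) (P.state (K p) (b p) (P.x s) n) (P.y s) :=
    continuous_finsetSum _ fun s _ => hP.continuous_error hW hc
      (continuous_state hL.continuous (P.x s) hK hb n) (P.y s)
  have h1 := (continuous_discreteReg (continuous_of_definite _ hP.normdd_def) P.τ₁).comp hK
  have h2 := (continuous_discreteReg (continuous_of_definite _ hP.normd_def) P.τ₂).comp hb
  have h3 := ((continuous_of_definite _ hP.normmd_def).comp hW).pow 2
  have h4 := ((continuous_of_definite _ hP.normm_def).comp hc).pow 2
  exact (((h0.add (h1.const_mul P.α₁)).add (h2.const_mul P.α₂)).add (h3.const_mul P.α₃)).add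
    (h4.const_mul P.α₄)

theorem Admissible.exists_isMinimiser (hP : P.Admissible) (n : ℕ) :
    ∃ θ : DiscreteParam d m n, P.IsMinimiser n θ := by
  let Q := (Fin n → Matrix (Fin d) (Fin d) ℝ) × (Fin n → Fin d → ℝ) ×
    Matrix (Fin m) (Fin d) ℝ × (Fin m → ℝ)
  let ofQ : Q → DiscreteParam d m n := fun p => ⟨p.1, p.2.1, p.2.2.1, p.2.2.2⟩
  have hcont : Continuous fun p : Q => P.energy n (ofQ p) :=
    hP.continuous_energy continuous_fst (continuous_fst.comp continuous_snd)
      (continuous_fst.comp (continuous_snd.comp continuous_snd))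
      (continuous_snd.comp (continuous_snd.comp continuous_snd))
  obtain ⟨R, hR0, hR⟩ := hP.exists_boundedBy (P.energy n (ofQ 0))
  obtain ⟨p, hp⟩ := hcont.exists_forall_le_of_isBounded 0 (by
    refine Metric.isBounded_closedBall (x := (0 : Q)) (r := R) |>.subset fun p hp => ?_
    have h := hR n (ofQ p) hp
    rw [mem_closedBall_zero_iff]
    have hK' : ‖p.1‖ ≤ R := (pi_norm_le_iff_of_nonneg hR0).2 fun i => by
      simpa [layer, ofQ] using h.K i
    have hb' : ‖p.2.1‖ ≤ R := (pi_norm_le_iff_of_nonneg hR0).2 fun i => by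
      simpa [layer, ofQ] using h.b i
    exact max_le hK' (max_le hb' (max_le h.W h.c)))
  exact ⟨ofQ p, fun θ' => hp (θ'.K, θ'.b, θ'.W, θ'.c)⟩

/-! ### The discrete-to-continuum distance -/

theorem Admissible.tendsto_dist (hP : P.Admissible) {n : ℕ → ℕ}
    {θ : ∀ k, DiscreteParam d m (n k)} {θ₀ : ContParam d m} {R : ℝ}
    (hR : ∀ k, BoundedBy (θ k) R) (h : PointwiseLimit θ θ₀) :
    Tendsto (fun k => P.dist (θ k) θ₀) atTop (𝓝 0) := by
  have h1 := tendsto_distL2_extend P.normdd hP.normdd_def θ₀.memH1_K.continuousOn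
    (fun k => (hR k).K) h.K
  have h2 := tendsto_distL2_extend P.normd hP.normd_def θ₀.memH1_b.continuousOn
    (fun k => (hR k).b) h.b
  have h3 : Tendsto (fun k => P.normmd ((θ k).W - θ₀.W)) atTop (𝓝 0) := by
    have := ((continuous_of_definite _ hP.normmd_def).tendsto _).comp (h.W.sub_const θ₀.W)
    simpa [Function.comp_def] using this
  have h4 : Tendsto (fun k => P.normm ((θ k).c - θ₀.c)) atTop (𝓝 0) := by
    have := ((continuous_of_definite _ hP.normm_def).tendsto _).comp (h.c.sub_const θ₀.c)
    simpa [Function.comp_def] using this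
  simpa [dist] using ((h1.add h2).add h3).add h4

theorem distL2_nonneg {V : Type*} [AddCommGroup V] [Module ℝ V] (N : Seminorm ℝ V)
    (u v : ℝ → V) : 0 ≤ distL2 N u v := Real.sqrt_nonneg _

/-- Limits with respect to a definite seminorm are unique. -/
theorem eq_of_tendsto_seminorm_sub {V : Type*} [AddCommGroup V] [Module ℝ V] (N : Seminorm ℝ V)
    (hN : ∀ v, N v = 0 → v = 0) {w : ℕ → V} {a a' : V}
    (ha : Tendsto (fun k => N (w k - a)) atTop (𝓝 0))
    (ha' : Tendsto (fun k => N (w k - a')) atTop (𝓝 0)) : a = a' := by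
  have h := ha'.add ha
  rw [add_zero] at h
  refine sub_eq_zero.1 (hN _ (le_antisymm (ge_of_tendsto' h fun k => ?_) (apply_nonneg N _)))
  calc N (a - a') = N ((w k - a') - (w k - a)) := by congr 1; abel
    _ ≤ _ := map_sub_le_add N _ _

theorem contReg_congr {V : Type*} [NormedAddCommGroup V] [NormedSpace ℝ V] [CompleteSpace V]
    (N : Seminorm ℝ V) (τ : ℝ) {f g : ℝ → V} (hf : MemH1 f) (hfg : EqOn g f (Icc 0 1)) :
    contReg N τ g = contReg N τ f := by
  have hw := hf.hasL2WeakDeriv.weakDeriv_spec.1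
  rw [contReg_of_eq_primitive N τ hw hf.eq_primitive, contReg_of_eq_primitive N τ hw
    fun t ht => (hfg ht).trans (hf.eq_primitive t ht)]

theorem Admissible.exists_isSolution_unique (hP : P.Admissible) (θ : ContParam d m)
    (x₀ : Fin d → ℝ) : ∃ X, P.IsSolution θ.K θ.b x₀ X ∧
      ∀ X', P.IsSolution θ.K θ.b x₀ X' → EqOn X' X (Icc 0 1) := by
  obtain ⟨L, hL⟩ := hP.lipschitz_σ
  obtain ⟨X, hX⟩ := exists_isSolution hL θ.memH1_K.continuousOn θ.memH1_b.continuousOn x₀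
  exact ⟨X, hX, fun X' hX' => hX'.eqOn hL θ.memH1_K.continuousOn hX⟩

/-- The limiting energy only depends on the values of `K` and `b` on `[0,1]`. -/
theorem Admissible.limitEnergy_congr (hP : P.Admissible) {θ₀ θ₁ : ContParam d m}
    (hK : EqOn θ₀.K θ₁.K (Icc 0 1)) (hb : EqOn θ₀.b θ₁.b (Icc 0 1)) (hW : θ₀.W = θ₁.W)
    (hc : θ₀.c = θ₁.c) : P.limitEnergy θ₀ = P.limitEnergy θ₁ := by
  obtain ⟨L, hL⟩ := hP.lipschitz_σ
  have hsol : ∀ x₀, P.solution θ₀.K θ₀.b x₀ 1 = P.solution θ₁.K θ₁.b x₀ 1 := by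
    intro x₀
    have h0 := isSolution_solution hL θ₀.memH1_K.continuousOn θ₀.memH1_b.continuousOn x₀
    have h1 := isSolution_solution hL θ₁.memH1_K.continuousOn θ₁.memH1_b.continuousOn x₀
    have h0' : P.IsSolution θ₁.K θ₁.b x₀ (P.solution θ₀.K θ₀.b x₀) :=
      ⟨h0.1, fun t ht => by rw [← hK ht, ← hb ht]; exact h0.2 t ht⟩
    exact h0'.eqOn hL θ₁.memH1_K.continuousOn h1 (by simp)
  rw [limitEnergy, limitEnergy, contReg_congr _ _ θ₁.memH1_K hK, contReg_congr _ _ θ₁.memH1_b hb,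
    hW, hc]
  simp only [hsol]

/-- Two limits of the same sequence agree on `[0,1]`, hence have the same limiting energy. -/
theorem Admissible.limitEnergy_eq_of_tendsto_dist (hP : P.Admissible) {n : ℕ → ℕ}
    {θ : ∀ k, DiscreteParam d m (n k)} {θ₀ θ₁ : ContParam d m}
    (h₀ : Tendsto (fun k => P.dist (θ k) θ₀) atTop (𝓝 0))
    (h₁ : Tendsto (fun k => P.dist (θ k) θ₁) atTop (𝓝 0)) :
    P.limitEnergy θ₀ = P.limitEnergy θ₁ := by
  have key : ∀ θ' : ContParam d m, Tendsto (fun k => P.dist (θ k) θ') atTop (𝓝 0) →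
      Tendsto (fun k => distL2 P.normdd (extend (θ k).K) θ'.K) atTop (𝓝 0) ∧
      Tendsto (fun k => distL2 P.normd (extend (θ k).b) θ'.b) atTop (𝓝 0) ∧
      Tendsto (fun k => P.normmd ((θ k).W - θ'.W)) atTop (𝓝 0) ∧
      Tendsto (fun k => P.normm ((θ k).c - θ'.c)) atTop (𝓝 0) := by
    intro θ' h
    have p1 := fun k => distL2_nonneg P.normdd (extend (θ k).K) θ'.K
    have p2 := fun k => distL2_nonneg P.normd (extend (θ k).b) θ'.b
    have p3 := fun k => apply_nonneg P.normmd ((θ k).W - θ'.W)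
    have p4 := fun k => apply_nonneg P.normm ((θ k).c - θ'.c)
    refine ⟨squeeze_zero p1 (fun k => ?_) h, squeeze_zero p2 (fun k => ?_) h,
      squeeze_zero p3 (fun k => ?_) h, squeeze_zero p4 (fun k => ?_) h⟩ <;>
    · rw [dist]
      linarith [p1 k, p2 k, p3 k, p4 k]
  obtain ⟨a1, a2, a3, a4⟩ := key θ₀ h₀
  obtain ⟨b1, b2, b3, b4⟩ := key θ₁ h₁
  exact hP.limitEnergy_congr
    (eqOn_of_tendsto_distL2 _ hP.normdd_def θ₀.memH1_K.continuousOn θ₁.memH1_K.continuousOn a1 b1)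
    (eqOn_of_tendsto_distL2 _ hP.normd_def θ₀.memH1_b.continuousOn θ₁.memH1_b.continuousOn a2 b2)
    (eq_of_tendsto_seminorm_sub _ hP.normmd_def a3 b3)
    (eq_of_tendsto_seminorm_sub _ hP.normm_def a4 b4)

/-! ### Γ-convergence -/

theorem Admissible.tendsto_sum_error (hP : P.Admissible) {n : ℕ → ℕ} (hn : ∀ k, 1 ≤ n k)
    (hnt : Tendsto n atTop atTop) {θ : ∀ k, DiscreteParam d m (n k)} {θ₀ : ContParam d m} {R : ℝ}
    (hR0 : 0 ≤ R) (hR : ∀ k, BoundedBy (θ k) R) (h : PointwiseLimit θ θ₀) :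
    Tendsto (fun k => ∑ s, P.error (θ k).W (θ k).c
        (P.state (θ k).K (θ k).b (P.x s) (n k)) (P.y s)) atTop
      (𝓝 (∑ s, P.error θ₀.W θ₀.c (P.solution θ₀.K θ₀.b (P.x s) 1) (P.y s))) := by
  obtain ⟨L, hL⟩ := hP.lipschitz_σ
  refine tendsto_finsetSum _ fun s _ => hP.tendsto_error h.W h.c ?_ _
  exact tendsto_state hL θ₀.memH1_K.continuousOn θ₀.memH1_b.continuousOn (P.x s) hn hnt hR0
    (fun k => (hR k).K) (fun k => (hR k).b) h.K h.b

/-- Compactness and the lower bound of Γ-convergence: networks of growing depth and bounded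
energy converge along a subsequence to a parameter in `Θ` whose limiting energy is at most the limit
of the energies. -/
theorem Admissible.exists_subseq_pointwiseLimit (hP : P.Admissible) {n : ℕ → ℕ}
    (hn : ∀ k, 1 ≤ n k) (hnt : Tendsto n atTop atTop) (θ : ∀ k, DiscreteParam d m (n k)) {A : ℝ}
    (hA : ∀ k, P.energy (n k) (θ k) ≤ A) :
    ∃ ψ : ℕ → ℕ, StrictMono ψ ∧ ∃ θ₀ : ContParam d m,
      PointwiseLimit (fun k => θ (ψ k)) θ₀ ∧
      ∃ e, Tendsto (fun k => P.energy (n (ψ k)) (θ (ψ k))) atTop (𝓝 e) ∧ P.limitEnergy θ₀ ≤ e := by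
  obtain ⟨R, hR0, hR⟩ := hP.exists_boundedBy A
  have hB := fun k => hR _ _ (hA k)
  -- the output layer
  obtain ⟨⟨W, c⟩, -, ψ₁, hψ₁, hlim₁⟩ := tendsto_subseq_of_bounded
    (s := Metric.closedBall (0 : Matrix (Fin m) (Fin d) ℝ) R ×ˢ Metric.closedBall (0 : Fin m → ℝ) R)
    (Metric.isBounded_closedBall.prod Metric.isBounded_closedBall)
    (x := fun k => ((θ k).W, (θ k).c))
    (fun k => ⟨by simpa using (hB k).W, by simpa using (hB k).c⟩)
  have hW : Tendsto (fun k => (θ (ψ₁ k)).W) atTop (𝓝 W) :=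
    Tendsto.comp (continuous_fst.tendsto (W, c)) hlim₁
  have hc : Tendsto (fun k => (θ (ψ₁ k)).c) atTop (𝓝 c) :=
    Tendsto.comp (continuous_snd.tendsto (W, c)) hlim₁
  -- the weights and the biases of the hidden layers
  obtain ⟨ψ₂, hψ₂, K, hKH, hKt, rK, hrK, hrK'⟩ := exists_subseq_tendsto_extend P.normdd
    hP.normdd_def hP.τ₁_pos (fun k => hn (ψ₁ k)) (hnt.comp hψ₁.tendsto_atTop)
    (fun k => (θ (ψ₁ k)).K) (fun k => (hP.terms_le (hA _)).1)
  obtain ⟨ψ₃, hψ₃, b, hbH, hbt, rb, hrb, hrb'⟩ := exists_subseq_tendsto_extend P.normd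
    hP.normd_def hP.τ₂_pos (fun k => hn (ψ₁ (ψ₂ k)))
    (hnt.comp (hψ₁.tendsto_atTop.comp hψ₂.tendsto_atTop))
    (fun k => (θ (ψ₁ (ψ₂ k))).b) (fun k => (hP.terms_le (hA _)).2.1)
  have h₃ := hψ₃.tendsto_atTop
  have h₂₃ := hψ₂.tendsto_atTop.comp h₃
  let θ₀ : ContParam d m := ⟨K, b, W, c, hKH, hbH⟩
  have hlim : PointwiseLimit (fun k => θ (ψ₁ (ψ₂ (ψ₃ k)))) θ₀ :=
    ⟨fun t ht => (hKt t ht).comp h₃, hbt, hW.comp h₂₃, hc.comp h₂₃⟩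
  refine ⟨fun k => ψ₁ (ψ₂ (ψ₃ k)), hψ₁.comp (hψ₂.comp hψ₃), θ₀, hlim, ?_⟩
  have herr := hP.tendsto_sum_error (fun k => hn _)
    (hnt.comp (hψ₁.tendsto_atTop.comp h₂₃)) hR0 (fun k => hB _) hlim
  have hWn := (((continuous_of_definite _ hP.normmd_def).tendsto W).comp hlim.W).pow 2
  have hcn := (((continuous_of_definite _ hP.normm_def).tendsto c).comp hlim.c).pow 2
  refine ⟨_, (((herr.add ((hrK.comp h₃).const_mul P.α₁)).add (hrb.const_mul P.α₂)).add
    (hWn.const_mul P.α₃)).add (hcn.const_mul P.α₄), ?_⟩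
  -- the error and the output terms converge, the other two are lower semicontinuous
  rw [limitEnergy]
  have := hP.α₁_pos
  have := hP.α₂_pos
  gcongr

/-- The network with `n` layers whose parameters are sampled from `θ`. -/
def sampleParam (θ : ContParam d m) (n : ℕ) : DiscreteParam d m n :=
  ⟨sample θ.K n, sample θ.b n, θ.W, θ.c⟩

theorem exists_boundedBy_sampleParam (θ : ContParam d m) :
    ∃ R : ℝ, 0 ≤ R ∧ ∀ n, BoundedBy (sampleParam θ n) R := by
  obtain ⟨M₁, hM₁⟩ := exists_bound_of_continuousOn_Icc θ.memH1_K.continuousOn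
  obtain ⟨M₂, hM₂⟩ := exists_bound_of_continuousOn_Icc θ.memH1_b.continuousOn
  have key : ∀ {V : Type} [NormedAddCommGroup V] (f : ℝ → V) (M : NNReal),
      (∀ t ∈ Icc (0 : ℝ) 1, ‖f t‖ ≤ M) → ∀ n i, ‖layer (sample f n) i‖ ≤ M := by
    intro V _ f M hM n i
    by_cases hi : i < n
    · rw [layer_sample f hi]
      have hn : (0 : ℝ) < n := by exact_mod_cast (Nat.zero_le i).trans_lt hi
      exact hM _ ⟨by positivity, (div_le_one hn).2 (by exact_mod_cast hi.le)⟩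
    · rw [layer, dif_neg hi, norm_zero]
      exact M.2
  refine ⟨M₁ + M₂ + ‖θ.W‖ + ‖θ.c‖, by positivity, fun n => ⟨fun i => ?_, fun i => ?_, ?_, ?_⟩⟩
  · exact (key _ _ hM₁ n i).trans (by linarith [M₂.2, norm_nonneg θ.W, norm_nonneg θ.c])
  · exact (key _ _ hM₂ n i).trans (by linarith [M₁.2, norm_nonneg θ.W, norm_nonneg θ.c])
  · change ‖θ.W‖ ≤ _
    linarith [M₁.2, M₂.2, norm_nonneg θ.c]
  · change ‖θ.c‖ ≤ _
    linarith [M₁.2, M₂.2, norm_nonneg θ.W]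

/-- The upper bound: sampling provides a recovery sequence for every parameter in `Θ`. -/
theorem Admissible.exists_upper_bound (hP : P.Admissible) (θ : ContParam d m) :
    ∃ e : ℕ → ℝ, Tendsto e atTop (𝓝 (P.limitEnergy θ)) ∧
      ∀ n, 1 ≤ n → P.energy n (sampleParam θ n) ≤ e n := by
  obtain ⟨R, hR0, hR⟩ := exists_boundedBy_sampleParam θ
  refine ⟨fun n => (∑ s : Fin S, P.error θ.W θ.c
      (P.state (sampleParam θ n).K (sampleParam θ n).b (P.x s) n) (P.y s))
      + P.α₁ * contReg P.normdd P.τ₁ θ.K + P.α₂ * contReg P.normd P.τ₂ θ.b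
      + P.α₃ * P.normmd θ.W ^ 2 + P.α₄ * P.normm θ.c ^ 2, ?_, fun n hn => ?_⟩
  · refine (((Tendsto.add_const _ ?_).add_const _).add_const _).add_const _
    rw [← tendsto_add_atTop_iff_nat 1]
    have hshift : Tendsto (fun k : ℕ => k + 1) atTop atTop := tendsto_add_atTop_nat 1
    exact hP.tendsto_sum_error (n := fun k => k + 1) (fun k => by omega) hshift
      (θ := fun k => sampleParam θ (k + 1)) (θ₀ := θ) hR0 (fun k => hR _)
      ⟨fun t ht => (tendsto_extend_sample θ.memH1_K.continuousOn ht).comp hshift,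
        fun t ht => (tendsto_extend_sample θ.memH1_b.continuousOn ht).comp hshift,
        tendsto_const_nhds, tendsto_const_nhds⟩
  · have h1 := discreteReg_sample_le P.normdd hP.normdd_def P.τ₁ θ.memH1_K hn
    have h2 := discreteReg_sample_le P.normd hP.normd_def P.τ₂ θ.memH1_b hn
    exact add_le_add (add_le_add (add_le_add (add_le_add le_rfl
      (mul_le_mul_of_nonneg_left h1 hP.α₁_pos.le)) (mul_le_mul_of_nonneg_left h2 hP.α₂_pos.le))
      le_rfl) le_rfl

/-- The energy of the zero parameters does not depend on the depth, so the minimal energies are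
bounded. -/
theorem energy_zero (P : Problem d m S) (n : ℕ) :
    P.energy n ⟨0, 0, 0, 0⟩ = ∑ s, P.normm (P.h 0 - P.y s) ^ 2 := by
  have hl : ∀ {V : Type} [AddCommGroup V] (i : ℕ), layer (0 : Fin n → V) i = 0 := by
    intro V _ i
    rw [layer]
    split_ifs <;> rfl
  simp [energy, error, discreteReg, hl]

/-- Minimisers of the discrete functionals converge along subsequences to minimisers of the
limiting functional, together with their energies. -/
theorem Admissible.exists_subseq_isLimitMinimiser (hP : P.Admissible)
    {θ : (n : ℕ) → DiscreteParam d m n} (hθ : ∀ n, 1 ≤ n → P.IsMinimiser n (θ n)) {φ : ℕ → ℕ}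
    (hφ : StrictMono φ) :
    ∃ ψ : ℕ → ℕ, StrictMono ψ ∧ ∃ θ₀ : ContParam d m, P.IsLimitMinimiser θ₀ ∧
      Tendsto (fun k => P.dist (θ (φ (ψ k))) θ₀) atTop (𝓝 0) ∧
      Tendsto (fun k => P.energy (φ (ψ k)) (θ (φ (ψ k)))) atTop (𝓝 (P.limitEnergy θ₀)) := by
  -- discard the first index, as `φ 0` may be `0`
  have hφ1 : ∀ k, 1 ≤ φ (k + 1) := fun k => (Nat.succ_le_succ k.zero_le).trans hφ.le_apply
  have hφt : Tendsto (fun k => φ (k + 1)) atTop atTop :=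
    hφ.tendsto_atTop.comp (tendsto_add_atTop_nat 1)
  have hA : ∀ k, P.energy (φ (k + 1)) (θ (φ (k + 1))) ≤ ∑ s, P.normm (P.h 0 - P.y s) ^ 2 :=
    fun k => (hθ _ (hφ1 k) _).trans_eq (energy_zero P _)
  obtain ⟨R, hR0, hR⟩ := hP.exists_boundedBy (∑ s, P.normm (P.h 0 - P.y s) ^ 2)
  obtain ⟨ψ, hψ, θ₀, hlim, e, he, hle⟩ := hP.exists_subseq_pointwiseLimit hφ1 hφt
    (fun k => θ (φ (k + 1))) hA
  -- comparison with the recovery sequence of an arbitrary competitor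
  have hupper : ∀ θ' : ContParam d m, e ≤ P.limitEnergy θ' := by
    intro θ'
    obtain ⟨e', he', hle'⟩ := hP.exists_upper_bound θ'
    exact le_of_tendsto_of_tendsto' he (he'.comp (hφt.comp hψ.tendsto_atTop)) fun k =>
      (hθ _ (hφ1 _) _).trans (hle' _ (hφ1 _))
  have heq : P.limitEnergy θ₀ = e := le_antisymm hle (hupper θ₀)
  refine ⟨fun k => ψ k + 1, fun i j hij => Nat.succ_lt_succ (hψ hij), θ₀, fun θ' => ?_,
    hP.tendsto_dist (fun k => hR _ _ (hA _)) hlim, ?_⟩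
  · rw [heq]; exact hupper θ'
  · rw [heq]; exact he

end Problem

end Energies

end DeepResNet

end

theorem theorem1 {d m S : ℕ} (P : DeepResNet.Problem d m S)
    (hnormd : ∀ v, P.normd v = 0 → v = 0) (hnormm : ∀ v, P.normm v = 0 → v = 0)
    (hnormdd : ∀ A, P.normdd A = 0 → A = 0) (hnormmd : ∀ A, P.normmd A = 0 → A = 0)
    (hα₁ : 0 < P.α₁) (hα₂ : 0 < P.α₂) (hα₃ : 0 < P.α₃) (hα₄ : 0 < P.α₄)
    (hτ₁ : 0 < P.τ₁) (hτ₂ : 0 < P.τ₂)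
    (hh : Continuous P.h) (hσ : ∃ L : NNReal, LipschitzWith L P.σ) (hσ0 : P.σ 0 = 0) :
    -- the differential equation has exactly one solution on `[0,1]`
    (∀ (θ : DeepResNet.ContParam d m) (x₀ : Fin d → ℝ), ∃ X, P.IsSolution θ.K θ.b x₀ X ∧
      ∀ X', P.IsSolution θ.K θ.b x₀ X' → Set.EqOn X' X (Set.Icc 0 1)) ∧
    -- minimisers exist
    (∀ n : ℕ, 1 ≤ n → ∃ θ, P.IsMinimiser n θ) ∧
    (∃ θ, P.IsLimitMinimiser θ) ∧
    ∀ θ : (n : ℕ) → DeepResNet.DiscreteParam d m n, (∀ n, 1 ≤ n → P.IsMinimiser n (θ n)) →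
      -- convergence of the minima
      (∀ θ₀, P.IsLimitMinimiser θ₀ →
        Filter.Tendsto (fun n => P.energy n (θ n)) Filter.atTop (nhds (P.limitEnergy θ₀))) ∧
      -- relative compactness: every subsequence has a convergent subsequence
      (∀ φ : ℕ → ℕ, StrictMono φ → ∃ ψ : ℕ → ℕ, StrictMono ψ ∧
        ∃ θ₀ : DeepResNet.ContParam d m,
          Filter.Tendsto (fun k => P.dist (θ (φ (ψ k))) θ₀) Filter.atTop (nhds 0)) ∧
      -- every limit point is a minimiser
      (∀ (φ : ℕ → ℕ) (θ₀ : DeepResNet.ContParam d m), StrictMono φ →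
        Filter.Tendsto (fun k => P.dist (θ (φ k)) θ₀) Filter.atTop (nhds 0) →
          P.IsLimitMinimiser θ₀) := by
  have hP : P.Admissible := ⟨hnormd, hnormm, hnormdd, hnormmd, hα₁, hα₂, hα₃, hα₄, hτ₁, hτ₂, hh, hσ⟩
  have hmin : ∀ n, ∃ θ, P.IsMinimiser n θ := hP.exists_isMinimiser
  refine ⟨hP.exists_isSolution_unique, fun n _ => hmin n, ?_,
    fun θ hθ => ⟨fun θ₀ hθ₀ => ?_, ?_, ?_⟩⟩
  · choose θ hθ using hmin
    obtain ⟨-, -, θ₀, hθ₀, -⟩ :=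
      hP.exists_subseq_isLimitMinimiser (fun n _ => hθ n) strictMono_id
    exact ⟨θ₀, hθ₀⟩
  · -- along a subsequence of any subsequence the energies converge to a minimum of the limiting
    -- functional, which is always the same number
    refine Filter.tendsto_of_subseq_tendsto fun ns hns => ?_
    obtain ⟨ρ, hρ, hρ'⟩ := Filter.strictMono_subseq_of_tendsto_atTop hns
    obtain ⟨ψ, -, θ₁, hθ₁, -, hE⟩ := hP.exists_subseq_isLimitMinimiser hθ hρ'
    exact ⟨fun k => ρ (ψ k), le_antisymm (hθ₁ θ₀) (hθ₀ θ₁) ▸ hE⟩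
  · intro φ hφ
    obtain ⟨ψ, hψ, θ₀, -, hd, -⟩ := hP.exists_subseq_isLimitMinimiser hθ hφ
    exact ⟨ψ, hψ, θ₀, hd⟩
  · intro φ θ₀ hφ hd θ'
    obtain ⟨ψ, hψ, θ₁, hθ₁, hd₁, -⟩ := hP.exists_subseq_isLimitMinimiser hθ hφ
    rw [hP.limitEnergy_eq_of_tendsto_dist (hd.comp hψ.tendsto_atTop) hd₁]
    exact hθ₁ θ'
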